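/- A metric measure space $(X,d,m)$ consists of a complete separable metric space $(X,d)$ and a Borel measure $m\neq 0$ on $X$ that is finite on bounded sets; a pointed one, $(X,d,m,x)$, has in addition a point $x\in X$. Let $C([0,1],X)$ carry the sup distance and its Borel $\sigma$-algebra, let $e_t(\gamma)=\gamma_t$, and call $\gamma\in C([0,1],X)$ a geodesic if $d(\gamma_s,\gamma_t)=|t-s|\,d(\gamma_0,\gamma_1)$ for all $s,t\in[0,1]$. For $q\in(1,\infty)$ and Borel probability measures $\mu_0,\mu_1$ on $X$, let $\mathrm{OptGeo}_q(\mu_0,\mu_1)$ be the set of Borel probability measures $\pi$ on $C([0,1],X)$ that are concentrated on geodesics and such that $(e_0,e_1)_\sharp\pi$ minimizes $\int d(x,y)^q\,\mathrm d\alpha(x,y)$ among all couplings $\alpha$ of $\mu_0$ and $\mu_1$. For each $q\in(1,\infty)$ let $C_q:(0,\infty)\to[1,\infty)$. We say that $(X,d,m)$ has the bounded interpolation property (BIP) with profile functions $D\mapsto C_q(D)$ if for all $q\in(1,\infty)$, all $D>0$ and all Borel probability measures $\mu_0=\rho_0m$, $\mu_1=\rho_1m$ on $X$ with $\rho_0,\rho_1\in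 L^\infty(m)$ and $\operatorname{diam}(\operatorname{supp}\mu_0\cup\operatorname{supp}\mu_1)<D$ there is $\pi\in\mathrm{OptGeo}_q(\mu_0,\mu_1)$ such that for every $t\in[0,1]$ $$(e_t)_\sharp\pi=\rho_tm\quad\text{with}\quad \|\rho_t\|_{L^\infty(m)}\le C_q(D)\,\max\{\|\rho_0\|_{L^\infty(m)},\|\rho_1\|_{L^\infty(m)}\}.$$ Pointed metric measure spaces $(X_n,d_n,m_n,x_n)$, $n\in\mathbb N$, pmGH-converge to $(X_\infty,d_\infty,m_\infty,x_\infty)$ if there are a complete separable metric space $Z$ and isometric embeddings $\iota_n:X_n\to Z$, $\iota_\infty:X_\infty\to Z$ such that $\iota_n(x_n)\to\iota_\infty(x_\infty)$ and $\int f\,\mathrm d(\iota_n)_\sharp m_n\to\int f\,\mathrm d(\iota_\infty)_\sharp m_\infty$ for every bounded continuous $f:Z\to\mathbb R$ with bounded support. **Theorem.** Let $(X_n,d_n,m_n,x_n)$, $n\in\mathbb N$, pmGH-converge to $(X_\infty,d_\infty,m_\infty,x_\infty)$. Suppose that, for every $n\in\mathbb N$, $(X_n,d_n,m_n)$ has the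 (BIP) with profile functions $D\mapsto C^n_q(D)$, and that functions $C_q:(0,\infty)\to\mathbb R$, $q\in(1,\infty)$, satisfy $$\limsup_{n\to\infty}C^n_q(D)\le C_q(D)<\infty\qquad\text{for every }D>0,\ q\in(1,\infty).$$ Then $(X_\infty,d_\infty,m_\infty)$ has the (BIP) with profile functions $D\mapsto C_q(D)$. -/

import Mathlib

open MeasureTheory Filter Topology

universe u v w

namespace BIP

/-- The space `C([0,1], X)` of continuous curves. Its topology is that of uniform convergence (the
domain is compact, and for metric `X` Mathlib's distance on it is the sup distance). -/
abbrev Curve (X : Type u) [TopologicalSpace X] : Type u := C(unitInterval, X)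

/-- `C([0,1], X)` carries its Borel σ-algebra. -/
instance instMeasurableSpaceCurve (X : Type u) [TopologicalSpace X] : MeasurableSpace (Curve X) :=
  borel (Curve X)

instance instBorelSpaceCurve (X : Type u) [TopologicalSpace X] : BorelSpace (Curve X) := ⟨rfl⟩

/-- `m` is a reference measure of a metric measure space: nonzero and finite on bounded sets. -/
structure IsReferenceMeasure {X : Type u} [MetricSpace X] [MeasurableSpace X]
    (m : Measure X) : Prop where
  ne_zero : m ≠ 0
  finite_of_bounded : ∀ s : Set X, Bornology.IsBounded s → m s < ⊤

/-- Constant speed, globally length minimizing geodesics parametrized on `[0,1]`. -/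
def IsGeodesic {X : Type u} [MetricSpace X] (γ : Curve X) : Prop :=
  ∀ s t : unitInterval, dist (γ s) (γ t) = |(t : ℝ) - (s : ℝ)| * dist (γ 0) (γ 1)

/-- `α` is an admissible transport plan between `μ₀` and `μ₁`. -/
def IsCoupling {X : Type u} [MeasurableSpace X] (μ₀ μ₁ : Measure X) (α : Measure (X × X)) : Prop :=
  IsProbabilityMeasure α ∧ α.map Prod.fst = μ₀ ∧ α.map Prod.snd = μ₁

/-- The transport cost `∫ d(x,y)^q dα(x,y)`. -/
noncomputable def cost {X : Type u} [MetricSpace X] [MeasurableSpace X] (q : ℝ)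
    (α : Measure (X × X)) : ENNReal :=
  ∫⁻ p, edist p.1 p.2 ^ q ∂α

/-- `α ∈ Opt_q(μ₀, μ₁)`: an admissible plan that minimizes the `q`-cost. -/
def IsOptimalPlan {X : Type u} [MetricSpace X] [MeasurableSpace X] (q : ℝ) (μ₀ μ₁ : Measure X)
    (α : Measure (X × X)) : Prop :=
  IsCoupling μ₀ μ₁ α ∧ ∀ β : Measure (X × X), IsCoupling μ₀ μ₁ β → cost q α ≤ cost q β

/-- `π ∈ OptGeo_q(μ₀, μ₁)`: a probability measure on curves, concentrated on geodesics, whose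
projection under `(e₀, e₁)` is an optimal plan. -/
def IsOptGeo {X : Type u} [MetricSpace X] [MeasurableSpace X] (q : ℝ) (μ₀ μ₁ : Measure X)
    (π : Measure (Curve X)) : Prop :=
  IsProbabilityMeasure π ∧ (∀ᵐ γ ∂π, IsGeodesic γ) ∧
    IsOptimalPlan q μ₀ μ₁ (π.map fun γ => (γ 0, γ 1))

/-- The `L^∞(m)` norm of the density of `μ` with respect to `m` (used for `μ ≪ m`). -/
noncomputable def densityNorm {X : Type u} [MeasurableSpace X] (m μ : Measure X) : ENNReal :=
  essSup (μ.rnDeriv m) m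

/-- The bounded interpolation property with profile functions `D ↦ C q D`, for `q ∈ (1, ∞)` and
`D ∈ (0, ∞)`, with values in `[1, ∞)`. -/
def HasBIP {X : Type u} [MetricSpace X] [MeasurableSpace X] (m : Measure X)
    (C : ℝ → ℝ → ℝ) : Prop :=
  ∀ q : ℝ, 1 < q → ∀ D : ℝ, 0 < D → 1 ≤ C q D ∧
    ∀ μ₀ μ₁ : Measure X, IsProbabilityMeasure μ₀ → IsProbabilityMeasure μ₁ →
      μ₀ ≪ m → μ₁ ≪ m → densityNorm m μ₀ < ⊤ → densityNorm m μ₁ < ⊤ →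
      Metric.ediam (μ₀.support ∪ μ₁.support) < ENNReal.ofReal D →
      ∃ π : Measure (Curve X), IsOptGeo q μ₀ μ₁ π ∧
        ∀ t : unitInterval, π.map (fun γ => γ t) ≪ m ∧
          densityNorm m (π.map fun γ => γ t) ≤
            ENNReal.ofReal (C q D) * max (densityNorm m μ₀) (densityNorm m μ₁)

/-- Pointed measured Gromov-Hausdorff convergence, in extrinsic form: isometric embeddings into
one complete separable metric space `Z` such that the base points converge and the push-forward
measures converge in duality with the bounded continuous functions of bounded support. -/
def PMGHConverges {X : ℕ → Type u} [∀ n, MetricSpace (X n)] [∀ n, MeasurableSpace (X n)]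
    (m : ∀ n, Measure (X n)) (x : ∀ n, X n)
    {Y : Type v} [MetricSpace Y] [MeasurableSpace Y] (mY : Measure Y) (y : Y) : Prop :=
  ∃ (Z : Type w) (_ : MetricSpace Z) (_ : CompleteSpace Z) (_ : TopologicalSpace.SeparableSpace Z)
    (_ : MeasurableSpace Z) (_ : BorelSpace Z) (ι : ∀ n, X n → Z) (ιY : Y → Z),
    (∀ n, Isometry (ι n)) ∧ Isometry ιY ∧
    Tendsto (fun n => ι n (x n)) atTop (𝓝 (ιY y)) ∧
    ∀ f : BoundedContinuousFunction Z ℝ, Bornology.IsBounded (Function.support f) →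
      Tendsto (fun n => ∫ z, f z ∂((m n).map (ι n))) atTop (𝓝 (∫ z, f z ∂(mY.map ιY)))

end BIP

namespace BIP

open scoped ENNReal NNReal BoundedContinuousFunction

/-! Work in the ambient space `Z`. Fix `μ₀, μ₁` on the limit space with densities at most `K`, and
an open `B` of diameter less than `D` that contains both supports and has a negligible boundary. Cut
`B` into finitely many cells with negligible boundary, small except for one residual cell of small
mass. By weak convergence, every cell has `mₙ`-mass at least its limit mass divided by `1 + η`, for
large `n`. Spreading the mass that `μᵢ` gives to each cell proportionally to `mₙ` therefore yields
measures on `Xₙ` with density at most `(1 + η) K`.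

The same redistribution, applied to products of cells, turns every coupling `β` of `μ₀, μ₁` into a
coupling of the new marginals that is close to `β` when tested on bounded Lipschitz functions
(`exists_transfer`). The marginals on `Xₙ` do not depend on `β`, so the single dynamical plan given
by the interpolation property of `Xₙ` has cost at most that of all these competitors
(`exists_approximating_plan`).

The time marginals of these plans are dominated by a weakly convergent sequence, hence tight.
Geodesics of bounded length that visit compact sets at a dense set of times form a compact set by
Arzelà–Ascoli, so the plans themselves are tight. A weak limit is carried by geodesics, inherits the
density bound and has cost at most that of every `β`, since the cost is bounded and continuous once
truncated at `D` (`exists_limit_plan`). Its marginals live on the closed image of the limit space,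
so it descends to a plan there (`exists_isOptGeo_of_ambient`). -/

/-! ### Density bounds and weak convergence of finite measures -/

theorem IsReferenceMeasure.sigmaFinite {X : Type u} [MetricSpace X] [MeasurableSpace X]
    {m : Measure X} (hm : IsReferenceMeasure m) (x : X) : SigmaFinite m := by
  refine ⟨⟨⟨fun n => Metric.closedBall x n, fun _ => trivial,
    fun n => hm.finite_of_bounded _ Metric.isBounded_closedBall, ?_⟩⟩⟩
  exact Metric.iUnion_closedBall_nat x

/-- With its converse below, this replaces bounds on densities by the order relation `μ ≤ K • m`,
which is stable under push-forward and weak limits. -/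
theorem le_smul_of_densityNorm_le {X : Type u} [MeasurableSpace X] {m μ : Measure X}
    [SigmaFinite m] [IsFiniteMeasure μ] (hac : μ ≪ m) {K : ℝ≥0∞} (hK : densityNorm m μ ≤ K) :
    μ ≤ K • m := by
  rw [← Measure.withDensity_rnDeriv_eq μ m hac, ← withDensity_const]
  refine withDensity_mono ?_
  filter_upwards [ENNReal.ae_le_essSup (μ := m) (μ.rnDeriv m)] with x hx using hx.trans hK

theorem densityNorm_le_of_le_smul {X : Type u} [MeasurableSpace X] {m μ : Measure X}
    [SigmaFinite m] {K : ℝ≥0∞} (h : μ ≤ K • m) :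
    μ ≪ m ∧ densityNorm m μ ≤ K := by
  refine ⟨(Measure.absolutelyContinuous_of_le h).trans Measure.smul_absolutelyContinuous, ?_⟩
  refine essSup_le_of_ae_le K ?_
  refine ae_le_of_forall_setLIntegral_le_of_sigmaFinite (μ.measurable_rnDeriv m)
    fun s _ _ => ?_
  refine (Measure.setLIntegral_rnDeriv_le s).trans ((h s).trans ?_)
  simp

/-- Domination of finite measures can be tested on bounded continuous functions. -/
theorem measure_le_of_forall_lintegral_le {Ω : Type*} [MetricSpace Ω]
    [MeasurableSpace Ω] [BorelSpace Ω] {μ ν : Measure Ω} [IsFiniteMeasure μ] [IsFiniteMeasure ν]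
    (h : ∀ f : Ω →ᵇ ℝ≥0, ∫⁻ x, f x ∂μ ≤ ∫⁻ x, f x ∂ν) : μ ≤ ν := by
  have hclosed : ∀ F : Set Ω, IsClosed F → μ F ≤ ν F := fun F hF =>
    le_of_tendsto_of_tendsto' (HasOuterApproxClosed.tendsto_lintegral_apprSeq hF μ)
      (HasOuterApproxClosed.tendsto_lintegral_apprSeq hF ν) fun n => h _
  refine Measure.le_iff.2 fun s hs => ?_
  rw [hs.measure_eq_iSup_isClosed_of_ne_top (measure_ne_top μ s)]
  exact iSup₂_le fun F hFs => iSup_le fun hF => (hclosed F hF).trans (measure_mono hFs)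

/-- A weakly convergent sequence of finite measures with nonzero limit is uniformly tight. -/
theorem exists_isCompact_compl_le_of_tendsto {Z : Type*} [MetricSpace Z] [CompleteSpace Z]
    [SecondCountableTopology Z] [MeasurableSpace Z] [BorelSpace Z]
    {l : ℕ → FiniteMeasure Z} {l' : FiniteMeasure Z} (hl : Tendsto l atTop (𝓝 l')) (h0 : l' ≠ 0)
    {ε : ℝ≥0∞} (hε : 0 < ε) :
    ∃ K : Set Z, IsCompact K ∧ ∀ n, (l n : Measure Z) Kᶜ ≤ ε := by
  have hne : Nonempty Z := by
    by_contra hZ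
    rw [not_nonempty_iff] at hZ
    exact h0 (FiniteMeasure.eq_of_forall_toMeasure_apply_eq _ _ fun s _ => by
      simp [Measure.eq_zero_of_isEmpty])
  -- Prokhorov's theorem is applied to the normalized measures: a convergent sequence together with
  -- its limit is compact, hence tight. The bounded masses are multiplied back at the end.
  have hnorm := FiniteMeasure.tendsto_normalize_of_tendsto hl h0
  have hcomp : IsCompact (closure (Set.range fun n => (l n).normalize)) :=
    hnorm.isCompact_insert_range.closure_of_subset (Set.subset_insert _ _)
  have htight := isTightMeasureSet_iff_exists_isCompact_measure_compl_le.1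
    (isTightMeasureSet_of_isCompact_closure hcomp)
  obtain ⟨M, hM⟩ := hl.mass.bddAbove_range
  obtain ⟨K, hK, hKle⟩ := htight (ε / (M + 1)) (ENNReal.div_pos hε.ne' (by simp))
  refine ⟨K, hK, fun n => ?_⟩
  have h1 : ((l n).normalize : Measure Z) Kᶜ ≤ ε / (M + 1) := hKle _ ⟨_, ⟨n, rfl⟩, rfl⟩
  have h2 : (l n : Measure Z) Kᶜ = (l n).mass * ((l n).normalize : Measure Z) Kᶜ := by
    have := (l n).self_eq_mass_mul_normalize Kᶜ
    rw [← FiniteMeasure.ennreal_coeFn_eq_coeFn_toMeasure,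
      ← ProbabilityMeasure.ennreal_coeFn_eq_coeFn_toMeasure, this, ENNReal.coe_mul]
  rw [h2]
  calc ((l n).mass : ℝ≥0∞) * ((l n).normalize : Measure Z) Kᶜ
      ≤ (M + 1) * (ε / (M + 1)) := by
        gcongr
        exact (ENNReal.coe_le_coe.2 (hM ⟨n, rfl⟩)).trans le_self_add
    _ ≤ ε := ENNReal.mul_div_le

/-- The portmanteau theorem for the normalized measures, multiplied by the convergent total masses.
-/
theorem tendsto_finiteMeasure_of_null_frontier {Z : Type*} [MetricSpace Z]
    [MeasurableSpace Z] [BorelSpace Z]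
    {l : ℕ → FiniteMeasure Z} {l' : FiniteMeasure Z} (hl : Tendsto l atTop (𝓝 l')) (h0 : l' ≠ 0)
    {A : Set Z} (hA : (l' : Measure Z) (frontier A) = 0) :
    Tendsto (fun n => (l n : Measure Z) A) atTop (𝓝 ((l' : Measure Z) A)) := by
  have hne : Nonempty Z := by
    by_contra hZ
    rw [not_nonempty_iff] at hZ
    exact h0 (FiniteMeasure.eq_of_forall_toMeasure_apply_eq _ _ fun s _ => by
      simp [Measure.eq_zero_of_isEmpty])
  have hnorm := FiniteMeasure.tendsto_normalize_of_tendsto hl h0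
  have hmul : ∀ (ν : FiniteMeasure Z) (s : Set Z),
      (ν : Measure Z) s = ν.mass * (ν.normalize : Measure Z) s := fun ν s => by
    rw [← FiniteMeasure.ennreal_coeFn_eq_coeFn_toMeasure,
      ← ProbabilityMeasure.ennreal_coeFn_eq_coeFn_toMeasure, ν.self_eq_mass_mul_normalize s,
      ENNReal.coe_mul]
  have hfr : (l'.normalize : Measure Z) (frontier A) = 0 := by
    have := hmul l' (frontier A)
    rw [hA] at this
    have hm : (l'.mass : ℝ≥0∞) ≠ 0 :=
      ENNReal.coe_ne_zero.2 (l'.mass_nonzero_iff.2 h0)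
    exact (mul_eq_zero.1 this.symm).resolve_left hm
  have h1 := ProbabilityMeasure.tendsto_measure_of_null_frontier_of_tendsto' hnorm hfr
  simp only [hmul]
  exact ENNReal.Tendsto.mul (ENNReal.tendsto_coe.2 hl.mass) (Or.inr (measure_ne_top _ _)) h1
    (Or.inr ENNReal.coe_ne_top)

/-- Multiplying by a cutoff turns convergence against functions of bounded support into weak
convergence of finite measures that agree with the original ones on a given bounded set. -/
theorem exists_finiteMeasure_cutoff {Z : Type*} [MetricSpace Z] [MeasurableSpace Z] [BorelSpace Z]
    {m : ℕ → Measure Z} {m' : Measure Z}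
    (hm : ∀ n (s : Set Z), Bornology.IsBounded s → m n s < ⊤)
    (hm' : ∀ s : Set Z, Bornology.IsBounded s → m' s < ⊤)
    (hconv : ∀ f : BoundedContinuousFunction Z ℝ, Bornology.IsBounded (Function.support f) →
      Tendsto (fun n => ∫ z, f z ∂(m n)) atTop (𝓝 (∫ z, f z ∂m')))
    {B : Set Z} (hB : Bornology.IsBounded B) :
    ∃ (l : ℕ → FiniteMeasure Z) (l' : FiniteMeasure Z), Tendsto l atTop (𝓝 l') ∧
      (∀ n, (m n).restrict B ≤ l n) ∧ (∀ n, (l n : Measure Z) ≤ m n) ∧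
      m'.restrict B ≤ l' ∧ (l' : Measure Z) ≤ m' := by
  let g : Z →ᵇ ℝ≥0 := thickenedIndicator one_pos B
  have hgm : Measurable fun z => (g z : ℝ≥0∞) := by fun_prop
  have hg1 : ∀ z, (g z : ℝ≥0∞) ≤ 1 := fun z => by
    exact_mod_cast thickenedIndicator_le_one one_pos B z
  have hgB : ∀ z ∈ B, (g z : ℝ≥0∞) = 1 := fun z hz => by
    exact_mod_cast thickenedIndicator_one one_pos B hz
  have hgs : Function.support (fun z => (g z : ℝ≥0∞)) ⊆ Metric.thickening 1 B := by
    intro z hz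
    by_contra h
    exact hz (ENNReal.coe_eq_zero.2 (thickenedIndicator_zero one_pos B h))
  have hbdd : Bornology.IsBounded (Metric.thickening 1 B) := hB.thickening
  have hfin : ∀ ν : Measure Z, (∀ s : Set Z, Bornology.IsBounded s → ν s < ⊤) →
      IsFiniteMeasure (ν.withDensity fun z => (g z : ℝ≥0∞)) := fun ν hν => by
    refine isFiniteMeasure_withDensity ?_
    refine ((lintegral_mono (g := (Metric.thickening 1 B).indicator 1) fun z => ?_).trans_lt
      ?_).ne
    · by_cases hz : z ∈ Metric.thickening 1 B
      · simpa [hz] using hg1 z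
      · simp only [Set.indicator_of_notMem hz]
        exact (Function.notMem_support.1 fun h => hz (hgs h)).le
    · rw [lintegral_indicator_one Metric.isOpen_thickening.measurableSet]
      exact hν _ hbdd
  have hle : ∀ ν : Measure Z, (ν.withDensity fun z => (g z : ℝ≥0∞)) ≤ ν := fun ν => by
    calc _ ≤ ν.withDensity 1 := withDensity_mono (ae_of_all _ hg1)
      _ = ν := withDensity_one
  have hge : ∀ ν : Measure Z, ν.restrict B ≤ ν.withDensity fun z => (g z : ℝ≥0∞) := fun ν => by
    refine Measure.le_iff.2 fun s hs => ?_
    rw [Measure.restrict_apply hs, withDensity_apply _ hs]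
    -- `B` need not be measurable; the level set where the cutoff equals `1` is a measurable set
    -- containing it.
    have hT : MeasurableSet ((fun z => (g z : ℝ≥0∞)) ⁻¹' {1}) := hgm (measurableSet_singleton 1)
    calc ν (s ∩ B) ≤ ν (s ∩ (fun z => (g z : ℝ≥0∞)) ⁻¹' {1}) :=
          measure_mono fun z hz => ⟨hz.1, hgB z hz.2⟩
      _ = ∫⁻ z in s ∩ (fun z => (g z : ℝ≥0∞)) ⁻¹' {1}, g z ∂ν := by
          rw [setLIntegral_congr_fun (g := fun _ => 1) (hs.inter hT) fun z hz => hz.2]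
          simp
      _ ≤ _ := lintegral_mono_set Set.inter_subset_left
  let l : ℕ → FiniteMeasure Z := fun n => ⟨_, hfin _ (hm n)⟩
  let l' : FiniteMeasure Z := ⟨_, hfin _ hm'⟩
  refine ⟨l, l', ?_, fun n => hge _, fun n => hle _, hge _, hle _⟩
  rw [FiniteMeasure.tendsto_iff_forall_integral_tendsto]
  intro f
  have hint : ∀ ν : Measure Z, ∫ z, f z ∂(ν.withDensity fun z => (g z : ℝ≥0∞)) =
      ∫ z, (g z : ℝ) * f z ∂ν := fun ν => by
    rw [integral_withDensity_eq_integral_smul (by fun_prop)]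
    rfl
  let gf : Z →ᵇ ℝ := BoundedContinuousFunction.ofNormedAddCommGroup (fun z => (g z : ℝ) * f z)
    (by fun_prop) ‖f‖ fun z => by
      rw [norm_mul]
      have h1 : ‖(g z : ℝ)‖ ≤ 1 := by
        rw [Real.norm_of_nonneg (by positivity)]
        exact_mod_cast thickenedIndicator_le_one one_pos B z
      calc _ ≤ 1 * ‖f‖ := by gcongr; exact f.norm_coe_le_norm z
        _ = ‖f‖ := one_mul _
  have := hconv gf (hbdd.subset fun z hz => hgs fun h0 => hz (by
    have : g z = 0 := ENNReal.coe_eq_zero.1 h0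
    simp [gf, this]))
  simp only [l, l', FiniteMeasure.toMeasure_mk, hint]
  exact this

/-! ### Compactness and limits of measures on geodesics -/

section Curves

variable {Z : Type*} [MetricSpace Z]

theorem isClosed_setOf_isGeodesic : IsClosed {γ : Curve Z | IsGeodesic γ} := by
  simp only [IsGeodesic, Set.ofPred_forall]
  refine isClosed_iInter fun s => isClosed_iInter fun t => isClosed_eq ?_ ?_
  · exact (continuous_eval_const s).dist (continuous_eval_const t)
  · exact continuous_const.mul ((continuous_eval_const 0).dist (continuous_eval_const 1))

/-- Geodesics of length at most `L` that pass, at a dense set of times, through prescribed compact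
sets form a compact set of curves. -/
theorem isCompact_setOf_isGeodesic_of_dense [CompleteSpace Z] {T : ℕ → unitInterval}
    (hT : DenseRange T) {K : ℕ → Set Z} (hK : ∀ k, IsCompact (K k)) (L : ℝ) :
    IsCompact {γ : Curve Z | IsGeodesic γ ∧ dist (γ 0) (γ 1) ≤ L ∧ ∀ k, γ (T k) ∈ K k} := by
  rcases lt_or_ge L 0 with hL | hL
  · convert isCompact_empty
    ext γ
    simp only [Set.mem_ofPred_eq, Set.mem_empty_iff_false, iff_false, not_and]
    exact fun _ h => absurd (dist_nonneg.trans h) hL.not_ge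
  -- Arzelà–Ascoli asks for compactness of the set in the product topology; `P` is its image there.
  -- The common Lipschitz constant `L` supplies continuity and equicontinuity.
  set P : Set (unitInterval → Z) :=
    {f | (∀ s t, dist (f s) (f t) = |(t : ℝ) - (s : ℝ)| * dist (f 0) (f 1)) ∧
      dist (f 0) (f 1) ≤ L ∧ ∀ k, f (T k) ∈ K k} with hP
  have hlip : ∀ f ∈ P, LipschitzWith L.toNNReal f := fun f hf =>
    LipschitzWith.of_dist_le_mul fun s t => by
      rw [hf.1 s t, Real.coe_toNNReal L hL, mul_comm, dist_comm s t, Subtype.dist_eq,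
        Real.dist_eq]
      exact mul_le_mul_of_nonneg_right hf.2.1 (abs_nonneg _)
  have himage : ContinuousMap.toFun ''
      {γ : Curve Z | IsGeodesic γ ∧ dist (γ 0) (γ 1) ≤ L ∧ ∀ k, γ (T k) ∈ K k} = P := by
    ext f
    constructor
    · rintro ⟨γ, hγ, rfl⟩
      exact hγ
    · intro hf
      exact ⟨⟨f, (hlip f hf).continuous⟩, hf, rfl⟩
  have hclosed : IsClosed P := by
    simp only [hP, Set.ofPred_and, Set.ofPred_forall]
    refine (isClosed_iInter fun s => isClosed_iInter fun t => isClosed_eq ?_ ?_).inter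
      (IsClosed.inter ?_ (isClosed_iInter fun k => ?_))
    · fun_prop
    · fun_prop
    · exact isClosed_le (by fun_prop) continuous_const
    · exact (hK k).isClosed.preimage (continuous_apply _)
  have htb : ∀ t, TotallyBounded ((fun f : unitInterval → Z => f t) '' P) := fun t => by
    rw [Metric.totallyBounded_iff]
    intro ε hε
    -- The values at `t` are within `ε / 2` of values at a nearby time `T k`, which lie in a compact
    -- set. Using `L + 1` avoids division by zero.
    obtain ⟨k, hk⟩ := hT.exists_dist_lt t (show 0 < ε / (2 * (L + 1)) by positivity)
    obtain ⟨F, hF, hKF⟩ := Metric.totallyBounded_iff.1 (hK k).totallyBounded (ε / 2) (half_pos hε)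
    refine ⟨F, hF, ?_⟩
    rintro _ ⟨f, hf, rfl⟩
    obtain ⟨y, hy, hfy⟩ := Set.mem_iUnion₂.1 (hKF (hf.2.2 k))
    refine Set.mem_iUnion₂.2 ⟨y, hy, ?_⟩
    have h1 : dist (f t) (f (T k)) ≤ L * dist t (T k) := by
      simpa [Real.coe_toNNReal L hL] using (hlip f hf).dist_le_mul t (T k)
    have h2 : L * dist t (T k) ≤ ε / 2 := by
      calc L * dist t (T k) ≤ (L + 1) * (ε / (2 * (L + 1))) := by gcongr; linarith
        _ = ε / 2 := by field_simp
    rw [Metric.mem_ball] at hfy ⊢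
    linarith [dist_triangle (f t) (f (T k)) y]
  refine ArzelaAscoli.isCompact_of_equicontinuous _ ?_ ?_
  · rw [himage]
    refine (isCompact_univ_pi fun t => (htb t).closure.isCompact_of_isClosed
      isClosed_closure).of_isClosed_subset hclosed fun f hf t _ => subset_closure ⟨f, hf, rfl⟩
  · exact (LipschitzWith.uniformEquicontinuous _ L.toNNReal
      fun γ => hlip _ γ.2).equicontinuous

theorem measurable_eval [MeasurableSpace Z] [BorelSpace Z] (t : unitInterval) :
    Measurable fun γ : Curve Z => γ t :=
  (continuous_eval_const t).measurable

section Limit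

variable [CompleteSpace Z] [SecondCountableTopology Z] [MeasurableSpace Z] [BorelSpace Z]

/-- Measures on geodesics of bounded length whose time marginals are dominated by a weakly
convergent sequence subconverge. -/
theorem exists_subseq_tendsto_of_marginals_le {l : ℕ → FiniteMeasure Z} {l' : FiniteMeasure Z}
    (hl : Tendsto l atTop (𝓝 l')) (h0 : l' ≠ 0) (p : ℕ → ProbabilityMeasure (Curve Z)) (L : ℝ)
    (hgeo : ∀ k, ∀ᵐ γ ∂(p k : Measure (Curve Z)), IsGeodesic γ ∧ dist (γ 0) (γ 1) ≤ L)
    {c : ℝ≥0} (hle : ∀ k t, (p k : Measure (Curve Z)).map (fun γ => γ t) ≤ c • (l k : Measure Z)) :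
    ∃ (p' : ProbabilityMeasure (Curve Z)) (φ : ℕ → ℕ), StrictMono φ ∧
      Tendsto (p ∘ φ) atTop (𝓝 p') := by
  have htight : IsTightMeasureSet
      {((μ : ProbabilityMeasure (Curve Z)) : Measure (Curve Z)) | μ ∈ Set.range p} := by
    rw [isTightMeasureSet_iff_exists_isCompact_measure_compl_le]
    intro ε hε
    -- One share `ε' k` of the error for each time of the dense sequence; dividing by `c + 1`
    -- absorbs the factor `c` in the domination of the marginals.
    obtain ⟨ε', hε', hsum⟩ := ENNReal.exists_pos_sum_of_countable' hε.ne' ℕ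
    have hT := TopologicalSpace.denseRange_denseSeq unitInterval
    have hK : ∀ k, ∃ K : Set Z, IsCompact K ∧ ∀ n, (l n : Measure Z) Kᶜ ≤ ε' k / (c + 1) :=
      fun k => exists_isCompact_compl_le_of_tendsto hl h0
        (ENNReal.div_pos (hε' k).ne' (by simp))
    choose K hK hKle using hK
    refine ⟨_, isCompact_setOf_isGeodesic_of_dense hT hK L, ?_⟩
    rintro _ ⟨_, ⟨n, rfl⟩, rfl⟩
    have hsub : {γ : Curve Z | IsGeodesic γ ∧ dist (γ 0) (γ 1) ≤ L ∧
        ∀ k, γ (TopologicalSpace.denseSeq unitInterval k) ∈ K k}ᶜ ⊆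
        {γ : Curve Z | IsGeodesic γ ∧ dist (γ 0) (γ 1) ≤ L}ᶜ ∪
        ⋃ k, (fun γ : Curve Z => γ (TopologicalSpace.denseSeq unitInterval k)) ⁻¹' (K k)ᶜ := by
      intro γ hγ
      by_contra hcon
      simp only [Set.mem_union, Set.mem_iUnion, not_or, not_exists, Set.mem_preimage,
        Set.mem_compl_iff, not_not] at hcon
      exact hγ ⟨hcon.1.1, hcon.1.2, hcon.2⟩
    have hnull : (p n : Measure (Curve Z)) {γ | IsGeodesic γ ∧ dist (γ 0) (γ 1) ≤ L}ᶜ = 0 :=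
      hgeo n
    calc (p n : Measure (Curve Z)) _ ≤ _ := measure_mono hsub
      _ ≤ 0 + ∑' k, (p n : Measure (Curve Z))
          ((fun γ : Curve Z => γ (TopologicalSpace.denseSeq unitInterval k)) ⁻¹' (K k)ᶜ) :=
        (measure_union_le _ _).trans (add_le_add hnull.le (measure_iUnion_le _))
      _ ≤ ∑' k, ε' k := by
        rw [zero_add]
        refine ENNReal.tsum_le_tsum fun k => ?_
        rw [← Measure.map_apply (measurable_eval _) (hK k).isClosed.measurableSet.compl]
        refine (hle n _ _).trans ?_
        rw [Measure.smul_apply, ENNReal.smul_def, smul_eq_mul]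
        calc (c : ℝ≥0∞) * (l n : Measure Z) (K k)ᶜ ≤ (c + 1) * (ε' k / (c + 1)) := by
              gcongr
              · exact le_self_add
              · exact hKle k n
          _ ≤ ε' k := ENNReal.mul_div_le
      _ ≤ ε := hsum.le
  obtain ⟨p', -, φ, hφ, hlim⟩ := (isCompact_closure_of_isTightMeasureSet htight).isSeqCompact
    fun n => subset_closure (Set.mem_range_self n)
  exact ⟨p', φ, hφ, hlim⟩

/-- Mass on a closed set is upper semicontinuous under weak convergence, so full mass persists. -/
theorem ae_of_tendsto_of_isClosed {Ω : Type*} [MetricSpace Ω] [MeasurableSpace Ω] [BorelSpace Ω]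
    {p : ℕ → ProbabilityMeasure Ω} {p' : ProbabilityMeasure Ω} (hp : Tendsto p atTop (𝓝 p'))
    {F : Set Ω} (hF : IsClosed F) (h : ∀ k, ∀ᵐ ω ∂(p k : Measure Ω), ω ∈ F) :
    ∀ᵐ ω ∂(p' : Measure Ω), ω ∈ F := by
  have h1 := ProbabilityMeasure.limsup_measure_closed_le_of_tendsto hp hF
  have h2 : ∀ k, (p k : Measure Ω) F = 1 := fun k => (prob_compl_eq_zero_iff hF.measurableSet).1 (h k)
  simp only [h2, limsup_const] at h1
  exact (prob_compl_eq_zero_iff hF.measurableSet).2 (le_antisymm prob_le_one h1)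

/-- Both sides converge when tested on nonnegative bounded continuous functions, and these detect
domination. -/
theorem le_smul_of_tendsto {Ω : Type*} [MetricSpace Ω] [MeasurableSpace Ω] [BorelSpace Ω]
    {p : ℕ → ProbabilityMeasure Ω} {p' : ProbabilityMeasure Ω} (hp : Tendsto p atTop (𝓝 p'))
    {l : ℕ → FiniteMeasure Ω} {l' : FiniteMeasure Ω} (hl : Tendsto l atTop (𝓝 l'))
    {c : ℕ → ℝ≥0} {c' : ℝ≥0} (hc : Tendsto c atTop (𝓝 c'))
    (hle : ∀ k, (p k : Measure Ω) ≤ c k • (l k : Measure Ω)) :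
    (p' : Measure Ω) ≤ c' • (l' : Measure Ω) := by
  refine measure_le_of_forall_lintegral_le fun f => ?_
  have h1 := ProbabilityMeasure.tendsto_iff_forall_lintegral_tendsto.1 hp f
  have h2 := FiniteMeasure.tendsto_iff_forall_lintegral_tendsto.1 hl f
  have h3 := ENNReal.Tendsto.mul (ENNReal.tendsto_coe.2 hc)
    (Or.inr (f.lintegral_lt_top_of_nnreal _).ne) h2 (Or.inr ENNReal.coe_ne_top)
  refine (le_of_tendsto_of_tendsto' h1 h3 fun k => ?_).trans_eq ?_
  · refine (lintegral_mono' (hle k) le_rfl).trans_eq ?_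
    rw [lintegral_smul_measure, ENNReal.smul_def, smul_eq_mul]
  · rw [lintegral_smul_measure, ENNReal.smul_def, smul_eq_mul]

end Limit

end Curves

/-! ### Finite partitions and redistribution of mass in cells -/

section Cells

theorem measure_frontier_inter_eq_zero {Z : Type*} [TopologicalSpace Z] [MeasurableSpace Z]
    {ν : Measure Z} {s t : Set Z} (hs : ν (frontier s) = 0) (ht : ν (frontier t) = 0) :
    ν (frontier (s ∩ t)) = 0 :=
  measure_mono_null ((frontier_inter_subset s t).trans
    (Set.union_subset_union Set.inter_subset_left Set.inter_subset_right))
    (measure_union_null hs ht)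

theorem measure_frontier_biUnion_range_eq_zero {Z : Type*} [TopologicalSpace Z]
    [MeasurableSpace Z] {ν : Measure Z} {U : ℕ → Set Z} (hU : ∀ i, ν (frontier (U i)) = 0)
    (n : ℕ) : ν (frontier (⋃ i ∈ Finset.range n, U i)) = 0 := by
  induction n with
  | zero => simp
  | succ n ih =>
    rw [Finset.range_add_one, Finset.set_biUnion_insert]
    exact measure_mono_null ((frontier_union_subset _ _).trans
      (Set.union_subset_union Set.inter_subset_left Set.inter_subset_right))
      (measure_union_null (hU n) ih)

/-- A set with negligible boundary splits into finitely many pieces with negligible boundary, all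
of small diameter except for one piece of small measure. -/
theorem exists_cells {Z : Type*} [MetricSpace Z] [SecondCountableTopology Z] [MeasurableSpace Z]
    [BorelSpace Z] (ν : Measure Z) [SFinite ν] (μ : Measure Z) [IsFiniteMeasure μ] {B : Set Z}
    (hB : MeasurableSet B) (hfr : ν (frontier B) = 0) {δ : ℝ} (hδ : 0 < δ) :
    ∃ (N : ℕ) (A : Option (Fin N) → Set Z), (∀ i, MeasurableSet (A i)) ∧
      Pairwise (Function.onFun Disjoint A) ∧ ⋃ i, A i = B ∧ (∀ i, ν (frontier (A i)) = 0) ∧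
      (∀ i, ∀ x ∈ A (some i), ∀ y ∈ A (some i), dist x y ≤ δ) ∧
      μ (A none) ≤ ENNReal.ofReal δ := by
  rcases isEmpty_or_nonempty Z with hZ | hZ
  · refine ⟨0, fun _ => B, fun _ => hB, ?_, ?_, fun _ => hfr, fun i => i.elim0, ?_⟩
    · exact fun i j _ => by simp [Function.onFun, Set.eq_empty_of_isEmpty B]
    · exact Set.iUnion_const B
    · simp [Set.eq_empty_of_isEmpty B]
  -- The upper bound on the radius keeps diameters at most `δ`; the lower bound makes the balls
  -- around a dense sequence cover `Z`. A radius with negligible boundary exists in every such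
  -- interval.
  have hr : ∀ z : Z, ∃ r ∈ Set.Ioo (δ / 4) (δ / 2), ν (frontier (Metric.thickening r {z})) = 0 :=
    fun z => exists_null_frontier_thickening ν {z} (by linarith)
  choose r hr hrfr using hr
  set z := TopologicalSpace.denseSeq Z
  set U : ℕ → Set Z := fun j => Metric.thickening (r (z j)) {z j} with hU
  have hUball : ∀ j, U j = Metric.ball (z j) (r (z j)) := fun j => Metric.thickening_singleton _ _
  have hUm : ∀ j, MeasurableSet (U j) := fun j => Metric.isOpen_thickening.measurableSet
  set V : ℕ → Set Z := fun n => ⋃ i ∈ Finset.range n, U i with hV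
  have hVm : ∀ n, MeasurableSet (V n) := fun n => Finset.measurableSet_biUnion _ fun i _ => hUm i
  have hVfr : ∀ n, ν (frontier (V n)) = 0 :=
    measure_frontier_biUnion_range_eq_zero fun i => hrfr (z i)
  have hVmono : Monotone V := fun a b hab =>
    Set.biUnion_subset_biUnion_left fun i hi => by simp at hi ⊢; omega
  have hUV : ∀ {i n : ℕ}, i < n → U i ⊆ V n := fun {i n} hin =>
    Set.subset_biUnion_of_mem (u := U) (Finset.mem_coe.2 (Finset.mem_range.2 hin))
  have hcover : ∀ x, ∃ n, x ∈ U n := fun x => by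
    obtain ⟨n, hn⟩ := (TopologicalSpace.denseRange_denseSeq Z).exists_dist_lt x
      (show 0 < δ / 4 by positivity)
    exact ⟨n, by rw [hUball]; exact hn.trans (hr _).1⟩
  have hlim : Tendsto (fun n => μ (V n)ᶜ) atTop (𝓝 0) := by
    have := tendsto_measure_iInter_atTop (μ := μ) (s := fun n => (V n)ᶜ)
      (fun n => (hVm n).compl.nullMeasurableSet)
      (fun a b hab => Set.compl_subset_compl.2 (hVmono hab)) ⟨0, measure_ne_top _ _⟩
    have hempty : ⋂ n, (V n)ᶜ = ∅ := by
      rw [← Set.compl_iUnion, Set.compl_empty_iff, Set.eq_univ_iff_forall]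
      intro x
      obtain ⟨n, hn⟩ := hcover x
      exact Set.mem_iUnion.2 ⟨n + 1, hUV n.lt_succ_self hn⟩
    rwa [hempty, measure_empty] at this
  obtain ⟨N, hN⟩ := (hlim.eventually_le_const (ENNReal.ofReal_pos.2 hδ)).exists
  -- Each ball is stripped of the earlier ones; `none` collects what the first `N` balls miss.
  let A : Option (Fin N) → Set Z := fun i => i.elim (B ∩ (V N)ᶜ) fun j => B ∩ (U j ∩ (V j)ᶜ)
  refine ⟨N, A, ?_, ?_, ?_, ?_, ?_, (measure_mono Set.inter_subset_right).trans hN⟩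
  · rintro (_ | j)
    · exact hB.inter (hVm N).compl
    · exact hB.inter ((hUm j).inter (hVm j).compl)
  · have hsome : ∀ i j : Fin N, i < j → Disjoint (A (some i)) (A (some j)) := fun i j hij =>
      Set.disjoint_left.2 fun x hx hy => hy.2.2 (hUV hij hx.2.1)
    rintro (_ | i) (_ | j) hij
    · exact absurd rfl hij
    · exact Set.disjoint_left.2 fun x hx hy => hx.2 (hUV j.2 hy.2.1)
    · exact Set.disjoint_left.2 fun x hx hy => hy.2 (hUV i.2 hx.2.1)
    · rcases lt_or_gt_of_ne (fun h => hij (congrArg some h) : i ≠ j) with h | h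
      · exact hsome i j h
      · exact (hsome j i h).symm
  · refine Set.Subset.antisymm (Set.iUnion_subset ?_) fun x hx => ?_
    · rintro (_ | j) <;> exact Set.inter_subset_left
    · by_cases hxV : x ∈ V N
      · classical
        obtain ⟨k, hk, hxk⟩ := Set.mem_iUnion₂.1 hxV
        have hfind := Nat.find_spec (hcover x)
        have hlt : Nat.find (hcover x) < N :=
          (Nat.find_min' (hcover x) hxk).trans_lt (Finset.mem_range.1 hk)
        refine Set.mem_iUnion.2 ⟨some ⟨_, hlt⟩, hx, hfind, fun hxV' => ?_⟩
        obtain ⟨i, hi, hxi⟩ := Set.mem_iUnion₂.1 hxV'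
        exact Nat.find_min (hcover x) (Finset.mem_range.1 hi) hxi
      · exact Set.mem_iUnion.2 ⟨none, hx, hxV⟩
  · rintro (_ | j)
    · exact measure_frontier_inter_eq_zero hfr (by rw [frontier_compl]; exact hVfr N)
    · exact measure_frontier_inter_eq_zero hfr
        (measure_frontier_inter_eq_zero (hrfr _) (by rw [frontier_compl]; exact hVfr j))
  · intro j x hx y hy
    have h1 : dist x (z j) < r (z j) := by simpa [hUball] using hx.2.1
    have h2 : dist y (z j) < r (z j) := by simpa [hUball] using hy.2.1
    linarith [dist_triangle_right x y (z j), (hr (z j)).2]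

theorem sum_measure_inter_eq {Y I : Type*} [Fintype I] [MeasurableSpace Y] {μ : Measure Y}
    {E : I → Set Y} (hE : ∀ i, MeasurableSet (E i)) (hd : Pairwise (Function.onFun Disjoint E))
    (hcov : ∀ᵐ y ∂μ, y ∈ ⋃ i, E i) {s : Set Y} (hs : MeasurableSet s) :
    ∑ i, μ (s ∩ E i) = μ s := by
  rw [← tsum_fintype (L := .unconditional I), ← measure_iUnion (fun i j hij => (hd hij).mono Set.inter_subset_right
    Set.inter_subset_right) (fun i => hs.inter (hE i)), ← Set.inter_iUnion]
  refine measure_congr ?_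
  filter_upwards [hcov] with y hy
  exact propext ⟨fun h => h.1, fun h => ⟨h, hy⟩⟩

variable {Y W I : Type*} [Fintype I] [MeasurableSpace Y] [MeasurableSpace W]

/-- Redistribute the mass that `μ` gives to each cell `E i` according to `ν i`. -/
noncomputable def cellAverage (μ : Measure Y) (E : I → Set Y) (ν : I → Measure W) : Measure W :=
  ∑ i, μ (E i) • ν i

/-- Redistribute the mass that `β` gives to each product cell `E i × E j` according to
`ν i ⊗ ν j`. -/
noncomputable def cellCoupling (β : Measure (Y × Y)) (E : I → Set Y) (ν : I → Measure W) :
    Measure (W × W) :=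
  ∑ p : I × I, β (E p.1 ×ˢ E p.2) • (ν p.1).prod (ν p.2)

variable {E : I → Set Y} {ν : I → Measure W}

theorem isProbabilityMeasure_cellAverage [∀ i, IsProbabilityMeasure (ν i)]
    (hE : ∀ i, MeasurableSet (E i)) (hd : Pairwise (Function.onFun Disjoint E))
    {μ : Measure Y} [IsProbabilityMeasure μ] (hcov : ∀ᵐ y ∂μ, y ∈ ⋃ i, E i) :
    IsProbabilityMeasure (cellAverage μ E ν) := by
  refine ⟨?_⟩
  have := sum_measure_inter_eq hE hd hcov MeasurableSet.univ
  simpa [cellAverage] using this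

theorem sum_coupling_fst_eq (hE : ∀ i, MeasurableSet (E i))
    (hd : Pairwise (Function.onFun Disjoint E)) {μ₀ μ₁ : Measure Y} {β : Measure (Y × Y)}
    (hβ : IsCoupling μ₀ μ₁ β) (hcov₁ : ∀ᵐ y ∂μ₁, y ∈ ⋃ i, E i) (i : I) :
    ∑ j, β (E i ×ˢ E j) = μ₀ (E i) := by
  obtain ⟨hβp, rfl, rfl⟩ := hβ
  rw [Measure.map_apply measurable_fst (hE i),
    ← sum_measure_inter_eq (E := fun j => Prod.snd ⁻¹' E j) (fun j => measurable_snd (hE j))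
      (fun a b hab => (hd hab).preimage _)
      (by simpa using ae_of_ae_map measurable_snd.aemeasurable hcov₁)
      (measurable_fst (hE i))]
  exact Finset.sum_congr rfl fun j _ => by rw [Set.prod_eq]

theorem sum_coupling_snd_eq (hE : ∀ i, MeasurableSet (E i))
    (hd : Pairwise (Function.onFun Disjoint E)) {μ₀ μ₁ : Measure Y} {β : Measure (Y × Y)}
    (hβ : IsCoupling μ₀ μ₁ β) (hcov₀ : ∀ᵐ y ∂μ₀, y ∈ ⋃ i, E i) (j : I) :
    ∑ i, β (E i ×ˢ E j) = μ₁ (E j) := by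
  obtain ⟨hβp, rfl, rfl⟩ := hβ
  rw [Measure.map_apply measurable_snd (hE j),
    ← sum_measure_inter_eq (E := fun j => Prod.fst ⁻¹' E j) (fun j => measurable_fst (hE j))
      (fun a b hab => (hd hab).preimage _)
      (by simpa using ae_of_ae_map measurable_fst.aemeasurable hcov₀)
      (measurable_snd (hE j))]
  exact Finset.sum_congr rfl fun i _ => by rw [Set.prod_eq, Set.inter_comm]

/-- The marginals of `ν i ⊗ ν j` are `ν i` and `ν j`, so only the row and column sums of the matrix
`β (E i ×ˢ E j)` matter, and these are the cell masses of the marginals of `β`. -/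
theorem isCoupling_cellCoupling [∀ i, IsProbabilityMeasure (ν i)]
    (hE : ∀ i, MeasurableSet (E i)) (hd : Pairwise (Function.onFun Disjoint E))
    {μ₀ μ₁ : Measure Y} {β : Measure (Y × Y)} (hβ : IsCoupling μ₀ μ₁ β)
    (hcov₀ : ∀ᵐ y ∂μ₀, y ∈ ⋃ i, E i) (hcov₁ : ∀ᵐ y ∂μ₁, y ∈ ⋃ i, E i) :
    IsCoupling (cellAverage μ₀ E ν) (cellAverage μ₁ E ν) (cellCoupling β E ν) := by
  obtain ⟨hβp, rfl, rfl⟩ := hβ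
  have hfst := sum_coupling_fst_eq hE hd ⟨hβp, rfl, rfl⟩ hcov₁
  have hsnd := sum_coupling_snd_eq hE hd ⟨hβp, rfl, rfl⟩ hcov₀
  have h0 : (cellCoupling β E ν).map Prod.fst = cellAverage (β.map Prod.fst) E ν := by
    simp only [cellCoupling, cellAverage, ← Measure.mapₗ_apply_of_measurable measurable_fst,
      map_sum, map_smul]
    simp only [Measure.mapₗ_apply_of_measurable measurable_fst, Measure.map_fst_prod, measure_univ,
      one_smul, Fintype.sum_prod_type, ← Finset.sum_smul, hfst]
  have h1 : (cellCoupling β E ν).map Prod.snd = cellAverage (β.map Prod.snd) E ν := by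
    simp only [cellCoupling, cellAverage, ← Measure.mapₗ_apply_of_measurable measurable_snd,
      map_sum, map_smul]
    simp only [Measure.mapₗ_apply_of_measurable measurable_snd, Measure.map_snd_prod, measure_univ,
      one_smul, Fintype.sum_prod_type_right, ← Finset.sum_smul, hsnd]
  refine ⟨?_, h0, h1⟩
  have : IsProbabilityMeasure (β.map Prod.fst) := Measure.isProbabilityMeasure_map (by fun_prop)
  have := isProbabilityMeasure_cellAverage (ν := ν) hE hd hcov₀
  rw [← h0] at this
  exact Measure.isProbabilityMeasure_of_map Prod.fst

/-- Redistribution inside cells changes integrals by at most the oscillation over the cells. -/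
theorem abs_integral_cellCoupling_sub_le [∀ i, IsProbabilityMeasure (ν i)]
    (hE : ∀ i, MeasurableSet (E i)) (hd : Pairwise (Function.onFun Disjoint E))
    {β : Measure (Y × Y)} [IsProbabilityMeasure β]
    (hcov : ∀ᵐ y ∂β, y ∈ ⋃ p : I × I, E p.1 ×ˢ E p.2)
    {f : W × W → ℝ} {g : Y × Y → ℝ} (hf : ∀ i j, Integrable f ((ν i).prod (ν j)))
    (hg : Integrable g β) {c : I × I → ℝ}
    (hc : ∀ i j, β (E i ×ˢ E j) ≠ 0 → ∀ y ∈ E i ×ˢ E j,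
      ∀ᵐ w ∂(ν i).prod (ν j), |f w - g y| ≤ c (i, j)) :
    |∫ w, f w ∂(cellCoupling β E ν) - ∫ y, g y ∂β| ≤
      ∑ p : I × I, β.real (E p.1 ×ˢ E p.2) * c p := by
  have hEm : ∀ p : I × I, MeasurableSet (E p.1 ×ˢ E p.2) := fun p => (hE _).prod (hE _)
  have hEd : Pairwise (Function.onFun Disjoint fun p : I × I => E p.1 ×ˢ E p.2) := by
    rintro ⟨i, j⟩ ⟨i', j'⟩ hne
    by_cases h : i = i'
    · have : j ≠ j' := fun hj => hne (by rw [h, hj])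
      exact Set.Disjoint.set_prod_right (hd this) _ _
    · exact Set.Disjoint.set_prod_left (hd h) _ _
  have h1 : ∫ w, f w ∂(cellCoupling β E ν) =
      ∑ p : I × I, β.real (E p.1 ×ˢ E p.2) * ∫ w, f w ∂(ν p.1).prod (ν p.2) := by
    rw [cellCoupling, integral_finsetSum_measure
      fun p _ => (hf p.1 p.2).smul_measure (measure_ne_top _ _)]
    exact Finset.sum_congr rfl fun p _ => by rw [integral_smul_measure]; rfl
  have h2 : ∫ y, g y ∂β = ∑ p : I × I, ∫ y in E p.1 ×ˢ E p.2, g y ∂β := by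
    rw [← integral_iUnion_fintype hEm hEd fun p => hg.integrableOn]
    rw [Measure.restrict_eq_self_of_ae_mem hcov]
  rw [h1, h2, ← Finset.sum_sub_distrib]
  refine (Finset.abs_sum_le_sum_abs _ _).trans (Finset.sum_le_sum fun p _ => ?_)
  by_cases h0 : β (E p.1 ×ˢ E p.2) = 0
  · simp [Measure.real, h0, Measure.restrict_eq_zero.2 h0]
  have h3 : β.real (E p.1 ×ˢ E p.2) * ∫ w, f w ∂(ν p.1).prod (ν p.2) -
      ∫ y in E p.1 ×ˢ E p.2, g y ∂β =
      ∫ y in E p.1 ×ˢ E p.2, ((∫ w, f w ∂(ν p.1).prod (ν p.2)) - g y) ∂β := by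
    rw [integral_sub (integrable_const _) hg.integrableOn, setIntegral_const, smul_eq_mul]
  rw [h3, ← Real.norm_eq_abs, mul_comm]
  refine norm_setIntegral_le_of_norm_le_const (measure_lt_top _ _) fun y hy => ?_
  have h4 : (∫ w, f w ∂(ν p.1).prod (ν p.2)) - g y =
      ∫ w, (f w - g y) ∂(ν p.1).prod (ν p.2) := by
    rw [integral_sub (hf _ _) (integrable_const _)]
    simp
  rw [h4]
  have := norm_integral_le_of_norm_le_const (μ := (ν p.1).prod (ν p.2))
    (f := fun w => f w - g y) (hc p.1 p.2 h0 y hy)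
  simpa using this

theorem ae_cellAverage {μ : Measure Y} {P : W → Prop}
    (h : ∀ i, μ (E i) ≠ 0 → ∀ᵐ w ∂ν i, P w) : ∀ᵐ w ∂cellAverage μ E ν, P w := by
  rw [ae_iff, cellAverage, Measure.finsetSum_apply]
  refine Finset.sum_eq_zero fun i _ => ?_
  rw [Measure.smul_apply, smul_eq_mul, mul_eq_zero]
  by_cases h0 : μ (E i) = 0
  · exact Or.inl h0
  · exact Or.inr (h i h0)

/-- If the cell masses are controlled by those of `m`, averaging with respect to `m` on each cell
keeps the density bound. -/
theorem cellAverage_le_smul {m : Measure W} {F : I → Set W} (hF : ∀ i, MeasurableSet (F i))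
    (hd : Pairwise (Function.onFun Disjoint F)) (hfin : ∀ i, m (F i) ≠ ⊤)
    (hν : ∀ i, m (F i) ≠ 0 → ν i = ProbabilityTheory.cond m (F i)) {μ : Measure Y} {K : ℝ≥0∞}
    (hK : ∀ i, μ (E i) ≤ K * m (F i)) :
    cellAverage μ E ν ≤ K • m := by
  have h1 : ∀ i, μ (E i) • ν i ≤ K • m.restrict (F i) := fun i => by
    -- A cell that is null for `m` receives no mass, so `ν i` may be arbitrary there.
    by_cases h0 : m (F i) = 0
    · have : μ (E i) = 0 := by simpa [h0] using hK i
      simp [this, Measure.zero_le]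
    · rw [hν i h0, ProbabilityTheory.cond, smul_smul]
      refine Measure.le_iff.2 fun s hs => ?_
      simp only [Measure.smul_apply, smul_eq_mul]
      gcongr
      calc μ (E i) * (m (F i))⁻¹ ≤ K * m (F i) * (m (F i))⁻¹ := by gcongr; exact hK i
        _ = K := by rw [mul_assoc, ENNReal.mul_inv_cancel h0 (hfin i), mul_one]
  calc cellAverage μ E ν ≤ ∑ i, K • m.restrict (F i) := Finset.sum_le_sum fun i _ => h1 i
    _ = K • m.restrict (⋃ i, F i) := by
      rw [Measure.restrict_iUnion hd hF, Measure.sum_fintype, Finset.smul_sum]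
    _ ≤ K • m := by
      refine Measure.le_iff.2 fun s _ => ?_
      simp only [Measure.smul_apply, smul_eq_mul]
      gcongr
      exact Measure.restrict_le_self

end Cells

/-! ### Transfer of measures and couplings between spaces -/

/-- Transfer of a pair of measures, together with all their couplings, from one space to another
along a common finite partition of an ambient space. -/
theorem exists_transfer {Z Y W : Type*} [MetricSpace Z] [SecondCountableTopology Z]
    [MeasurableSpace Z] [BorelSpace Z]
    [MeasurableSpace Y] [MeasurableSpace W] [Nonempty W]
    {ιY : Y → Z} {ιW : W → Z} (hιY : Measurable ιY) (hιW : Measurable ιW)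
    {N : ℕ} {A : Option (Fin N) → Set Z} (hA : ∀ i, MeasurableSet (A i))
    (hd : Pairwise (Function.onFun Disjoint A)) {B : Set Z} (hAB : ⋃ i, A i = B) {δ : ℝ}
    (hδ : 0 < δ)
    (hdiam : ∀ i, ∀ x ∈ A (some i), ∀ y ∈ A (some i), dist x y ≤ δ)
    {m : Measure W} (hfin : ∀ i, m (ιW ⁻¹' A i) ≠ ⊤)
    {μ₀ μ₁ : Measure Y} [IsProbabilityMeasure μ₀] [IsProbabilityMeasure μ₁]
    (hB₀ : ∀ᵐ y ∂μ₀, ιY y ∈ B) (hB₁ : ∀ᵐ y ∂μ₁, ιY y ∈ B)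
    (hnone₀ : μ₀ (ιY ⁻¹' A none) ≤ ENNReal.ofReal δ)
    (hnone₁ : μ₁ (ιY ⁻¹' A none) ≤ ENNReal.ofReal δ) {K : ℝ≥0∞}
    (hK₀ : ∀ i, μ₀ (ιY ⁻¹' A i) ≤ K * m (ιW ⁻¹' A i))
    (hK₁ : ∀ i, μ₁ (ιY ⁻¹' A i) ≤ K * m (ιW ⁻¹' A i)) :
    ∃ ν₀ ν₁ : Measure W, IsProbabilityMeasure ν₀ ∧ IsProbabilityMeasure ν₁ ∧
      ν₀ ≤ K • m ∧ ν₁ ≤ K • m ∧ (∀ᵐ w ∂ν₀, ιW w ∈ B) ∧ (∀ᵐ w ∂ν₁, ιW w ∈ B) ∧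
      ∀ β, IsCoupling μ₀ μ₁ β → ∃ α, IsCoupling ν₀ ν₁ α ∧
        ∀ (f : Z × Z → ℝ) (M : ℝ) (L : ℝ≥0), (∀ x, |f x| ≤ M) → LipschitzWith L f →
          |∫ w, f (Prod.map ιW ιW w) ∂α - ∫ y, f (Prod.map ιY ιY y) ∂β| ≤
            (L + 4 * M) * δ := by
  classical
  set E : Option (Fin N) → Set Y := fun i => ιY ⁻¹' A i with hEdef
  set F : Option (Fin N) → Set W := fun i => ιW ⁻¹' A i with hFdef
  have hE : ∀ i, MeasurableSet (E i) := fun i => hιY (hA i)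
  have hF : ∀ i, MeasurableSet (F i) := fun i => hιW (hA i)
  have hEd : Pairwise (Function.onFun Disjoint E) := fun i j hij => (hd hij).preimage _
  have hFd : Pairwise (Function.onFun Disjoint F) := fun i j hij => (hd hij).preimage _
  have hEU : ⋃ i, E i = ιY ⁻¹' B := by rw [← hAB, Set.preimage_iUnion]
  have hFB : ∀ i, F i ⊆ ιW ⁻¹' B := fun i =>
    Set.preimage_mono (hAB ▸ Set.subset_iUnion A i)
  have hcov₀ : ∀ᵐ y ∂μ₀, y ∈ ⋃ i, E i := by rw [hEU]; exact hB₀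
  have hcov₁ : ∀ᵐ y ∂μ₁, y ∈ ⋃ i, E i := by rw [hEU]; exact hB₁
  -- The Dirac mass is a default that keeps every `ν i` a probability measure; it is used only on
  -- cells where `μ₀` and `μ₁` vanish.
  let ν : Option (Fin N) → Measure W := fun i =>
    if m (F i) = 0 then Measure.dirac (Classical.arbitrary W) else ProbabilityTheory.cond m (F i)
  have hν : ∀ i, m (F i) ≠ 0 → ν i = ProbabilityTheory.cond m (F i) := fun i hi => if_neg hi
  have hνp : ∀ i, IsProbabilityMeasure (ν i) := fun i => by
    by_cases hi : m (F i) = 0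
    · simp only [ν, if_pos hi]; infer_instance
    · rw [hν i hi]
      exact ProbabilityTheory.cond_isProbabilityMeasure_of_finite hi (hfin i)
  have hνF : ∀ i, m (F i) ≠ 0 → ∀ᵐ w ∂ν i, w ∈ F i := fun i hi => by
    rw [hν i hi]
    exact ProbabilityTheory.ae_cond_mem (hF i)
  have hm₀ : ∀ i, μ₀ (E i) ≠ 0 → m (F i) ≠ 0 := fun i hi h0 => hi (by
    simpa [← hFdef, show m (ιW ⁻¹' A i) = 0 from h0] using hK₀ i)
  have hm₁ : ∀ i, μ₁ (E i) ≠ 0 → m (F i) ≠ 0 := fun i hi h0 => hi (by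
    simpa [← hFdef, show m (ιW ⁻¹' A i) = 0 from h0] using hK₁ i)
  -- The new marginals are fixed before `β` is introduced, so one optimal plan between them can be
  -- compared with every coupling.
  refine ⟨cellAverage μ₀ E ν, cellAverage μ₁ E ν, isProbabilityMeasure_cellAverage hE hEd hcov₀,
    isProbabilityMeasure_cellAverage hE hEd hcov₁, cellAverage_le_smul hF hFd hfin hν hK₀,
    cellAverage_le_smul hF hFd hfin hν hK₁,
    ae_cellAverage fun i hi => (hνF i (hm₀ i hi)).mono fun w hw => hFB i hw,
    ae_cellAverage fun i hi => (hνF i (hm₁ i hi)).mono fun w hw => hFB i hw, fun β hβ => ?_⟩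
  refine ⟨cellCoupling β E ν, isCoupling_cellCoupling hE hEd hβ hcov₀ hcov₁,
    fun f M L hM hL => ?_⟩
  have hβp := hβ.1
  have hfm : Measurable f := hL.continuous.measurable
  have hβ₀ : ∀ᵐ y ∂β, y.1 ∈ ⋃ i, E i :=
    ae_of_ae_map measurable_fst.aemeasurable (by rw [hβ.2.1]; exact hcov₀)
  have hβ₁ : ∀ᵐ y ∂β, y.2 ∈ ⋃ i, E i :=
    ae_of_ae_map measurable_snd.aemeasurable (by rw [hβ.2.2]; exact hcov₁)
  have hcov : ∀ᵐ y ∂β, y ∈ ⋃ p : Option (Fin N) × Option (Fin N), E p.1 ×ˢ E p.2 := by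
    filter_upwards [hβ₀, hβ₁] with y h0 h1
    obtain ⟨i, hi⟩ := Set.mem_iUnion.1 h0
    obtain ⟨j, hj⟩ := Set.mem_iUnion.1 h1
    exact Set.mem_iUnion.2 ⟨(i, j), hi, hj⟩
  -- Oscillation is at most `L * δ` on products of small cells, for the max distance. A residual
  -- index costs the trivial bound `2 * M`, but has mass at most `δ` in either marginal: in total
  -- `(L + 4 * M) * δ`.
  let c : Option (Fin N) × Option (Fin N) → ℝ := fun p =>
    L * δ + (if p.1 = none then 2 * M else 0) + (if p.2 = none then 2 * M else 0)
  have hM0 : 0 ≤ M := by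
    obtain ⟨w⟩ := ‹Nonempty W›
    exact (abs_nonneg _).trans (hM (ιW w, ιW w))
  have hmain := abs_integral_cellCoupling_sub_le (ν := ν) hE hEd hcov
    (f := fun w => f (Prod.map ιW ιW w)) (g := fun y => f (Prod.map ιY ιY y)) (c := c)
    (fun i j => .of_bound (hfm.comp (hιW.prodMap hιW)).aestronglyMeasurable M
      (ae_of_all _ fun w => hM _))
    (.of_bound (hfm.comp (hιY.prodMap hιY)).aestronglyMeasurable M (ae_of_all _ fun w => hM _)) ?_
  · refine hmain.trans ?_
    have hsum : ∑ p : Option (Fin N) × Option (Fin N), β.real (E p.1 ×ˢ E p.2) * c p =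
        L * δ * (∑ i, ∑ j, β.real (E i ×ˢ E j)) + 2 * M * (∑ j, β.real (E none ×ˢ E j)) +
          2 * M * (∑ i, β.real (E i ×ˢ E none)) := by
      simp only [c, Fintype.sum_prod_type, mul_add, Finset.sum_add_distrib, mul_ite, mul_zero]
      congr 1
      · congr 1
        · simp only [Finset.mul_sum, mul_comm]
        · rw [Finset.sum_comm]
          simp only [Finset.sum_ite_eq', Finset.mem_univ, if_true, Finset.mul_sum, mul_comm]
      · simp only [Finset.sum_ite_eq', Finset.mem_univ, if_true, Finset.mul_sum, mul_comm]
    have h0 : ∀ i, ∑ j, β.real (E i ×ˢ E j) = μ₀.real (E i) := fun i => by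
      rw [Measure.real, ← sum_coupling_fst_eq hE hEd hβ hcov₁ i,
        ENNReal.toReal_sum fun _ _ => measure_ne_top _ _]
      rfl
    have h1 : ∀ j, ∑ i, β.real (E i ×ˢ E j) = μ₁.real (E j) := fun j => by
      rw [Measure.real, ← sum_coupling_snd_eq hE hEd hβ hcov₀ j,
        ENNReal.toReal_sum fun _ _ => measure_ne_top _ _]
      rfl
    have h2 : ∑ i, μ₀.real (E i) = 1 := by
      have := sum_measure_inter_eq hE hEd hcov₀ MeasurableSet.univ
      simp only [Set.univ_inter, measure_univ] at this
      simp only [Measure.real]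
      rw [← ENNReal.toReal_sum fun _ _ => measure_ne_top _ _, this, ENNReal.toReal_one]
    have h3 : μ₀.real (E none) ≤ δ := ENNReal.toReal_le_of_le_ofReal hδ.le hnone₀
    have h4 : μ₁.real (E none) ≤ δ := ENNReal.toReal_le_of_le_ofReal hδ.le hnone₁
    rw [hsum, h0, h1]
    simp only [h0, h2]
    nlinarith [mul_le_mul_of_nonneg_left h3 hM0, mul_le_mul_of_nonneg_left h4 hM0]
  · intro i j hij y hy
    have hi : m (F i) ≠ 0 := hm₀ i fun h => hij (by
      rw [← hβ.2.1, Measure.map_apply measurable_fst (hE i)] at h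
      exact measure_mono_null (fun p hp => hp.1) h)
    have hj : m (F j) ≠ 0 := hm₁ j fun h => hij (by
      rw [← hβ.2.2, Measure.map_apply measurable_snd (hE j)] at h
      exact measure_mono_null (fun p hp => hp.2) h)
    have hprod : ∀ᵐ w ∂(ν i).prod (ν j), w.1 ∈ F i ∧ w.2 ∈ F j :=
      (Measure.quasiMeasurePreserving_fst.ae (hνF i hi)).and
        (Measure.quasiMeasurePreserving_snd.ae (hνF j hj))
    have hbound : ∀ x y, |f x - f y| ≤ 2 * M := fun x y => by
      have := abs_sub (f x) (f y)
      linarith [hM x, hM y]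
    have hLδ : 0 ≤ L * δ := by positivity
    filter_upwards [hprod] with w hw
    rcases i with _ | i
    · refine (hbound _ _).trans ?_
      simp only [c, if_true]
      split_ifs <;> linarith
    rcases j with _ | j
    · refine (hbound _ _).trans ?_
      simp only [c, if_true]
      split_ifs <;> linarith
    simp only [c, reduceCtorEq, if_false, add_zero]
    rw [← Real.dist_eq]
    refine (hL.dist_le_mul _ _).trans (mul_le_mul_of_nonneg_left ?_ L.2)
    exact max_le (hdiam i _ hw.1 _ hy.1) (hdiam j _ hw.2 _ hy.2)

/-! ### Curves under isometric embeddings and the property in the ambient space -/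

section PushCurve

variable {X Z : Type*} [MetricSpace X] [MetricSpace Z] {ι : X → Z}

/-- Composition of curves with an isometric embedding. -/
def pushCurve (hι : Isometry ι) (γ : Curve X) : Curve Z :=
  (⟨ι, hι.continuous⟩ : C(X, Z)).comp γ

@[simp]
theorem pushCurve_apply (hι : Isometry ι) (γ : Curve X) (t : unitInterval) :
    pushCurve hι γ t = ι (γ t) := rfl

theorem isometry_pushCurve (hι : Isometry ι) : Isometry (pushCurve hι) :=
  Isometry.of_dist_eq fun γ γ' => by
    refine le_antisymm ((ContinuousMap.dist_le dist_nonneg).2 fun t => ?_)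
      ((ContinuousMap.dist_le dist_nonneg).2 fun t => ?_)
    · rw [pushCurve_apply, pushCurve_apply, hι.dist_eq]
      exact ContinuousMap.dist_apply_le_dist t
    · rw [← hι.dist_eq]
      exact ContinuousMap.dist_apply_le_dist (f := pushCurve hι γ) (g := pushCurve hι γ') t

theorem isGeodesic_pushCurve_iff (hι : Isometry ι) {γ : Curve X} :
    IsGeodesic (pushCurve hι γ) ↔ IsGeodesic γ := by
  simp only [IsGeodesic, pushCurve_apply, hι.dist_eq]

theorem mem_range_pushCurve_iff (hι : Isometry ι) {γ : Curve Z} :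
    γ ∈ Set.range (pushCurve hι) ↔ ∀ t, γ t ∈ Set.range ι := by
  constructor
  · rintro ⟨γ', rfl⟩ t
    exact ⟨γ' t, rfl⟩
  · intro h
    choose g hg using h
    have hcont : Continuous g := hι.isEmbedding.continuous_iff.2 (by
      have : ι ∘ g = γ := funext hg
      rw [this]; exact γ.continuous)
    exact ⟨⟨g, hcont⟩, ContinuousMap.ext hg⟩

/-- Curves in a complete space form a complete space, so the isometric image is closed. This allows
measures on curves to be pulled back. -/
theorem measurableEmbedding_pushCurve [CompleteSpace X] (hι : Isometry ι) :
    MeasurableEmbedding (pushCurve hι) :=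
  (isometry_pushCurve hι).isClosedEmbedding.measurableEmbedding

end PushCurve

theorem measurable_evalPair {Z : Type*} [MetricSpace Z] [SecondCountableTopology Z]
    [MeasurableSpace Z] [BorelSpace Z] :
    Measurable fun γ : Curve Z => (γ 0, γ 1) :=
  (measurable_eval 0).prodMk (measurable_eval 1)

/-- The bounded interpolation property, seen in an ambient space. -/
theorem HasBIP.exists_ambient_plan {X : Type u} {Z : Type*} [MetricSpace X]
    [SecondCountableTopology X] [MeasurableSpace X] [BorelSpace X] [MetricSpace Z]
    [SecondCountableTopology Z] [MeasurableSpace Z] [BorelSpace Z] {m : Measure X} [SigmaFinite m]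
    {C : ℝ → ℝ → ℝ} (hC : HasBIP m C) {ι : X → Z} (hι : Isometry ι) {q D : ℝ} (hq : 1 < q)
    (hD : 0 < D) {B : Set Z} (hB : MeasurableSet B) (hBD : Metric.ediam B < ENNReal.ofReal D)
    {ν₀ ν₁ : Measure X} [IsProbabilityMeasure ν₀] [IsProbabilityMeasure ν₁] {K : ℝ≥0∞}
    (hK : K ≠ ⊤) (hK₀ : ν₀ ≤ K • m) (hK₁ : ν₁ ≤ K • m)
    (hB₀ : ∀ᵐ w ∂ν₀, ι w ∈ B) (hB₁ : ∀ᵐ w ∂ν₁, ι w ∈ B) :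
    ∃ p : ProbabilityMeasure (Curve Z),
      (∀ᵐ γ ∂(p : Measure (Curve Z)), IsGeodesic γ ∧ γ 0 ∈ B ∧ γ 1 ∈ B) ∧
      (∀ t, (p : Measure (Curve Z)).map (fun γ => γ t) ≤
        (ENNReal.ofReal (C q D) * K) • m.map ι) ∧
      (p : Measure (Curve Z)).map (fun γ => γ 0) = ν₀.map ι ∧
      (p : Measure (Curve Z)).map (fun γ => γ 1) = ν₁.map ι ∧
      ∀ α, IsCoupling ν₀ ν₁ α → ∫⁻ γ, edist (γ 0) (γ 1) ^ q ∂(p : Measure (Curve Z)) ≤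
        ∫⁻ z, edist z.1 z.2 ^ q ∂(α.map (Prod.map ι ι)) := by
  have hιm : Measurable ι := hι.continuous.measurable
  obtain ⟨hac₀, hn₀⟩ := densityNorm_le_of_le_smul hK₀
  obtain ⟨hac₁, hn₁⟩ := densityNorm_le_of_le_smul hK₁
  -- The supports lie only in the closure of the preimage of `B`, which has the same diameter as the
  -- preimage.
  have hsupp : ∀ ν : Measure X, (∀ᵐ w ∂ν, ι w ∈ B) → ν.support ⊆ closure (ι ⁻¹' B) := fun ν hν =>
    Measure.support_subset_of_isClosed isClosed_closure (hν.mono fun w hw => subset_closure hw)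
  have hdiam : Metric.ediam (ν₀.support ∪ ν₁.support) < ENNReal.ofReal D := by
    refine lt_of_le_of_lt ?_ hBD
    calc Metric.ediam (ν₀.support ∪ ν₁.support) ≤ Metric.ediam (closure (ι ⁻¹' B)) :=
          Metric.ediam_mono (Set.union_subset (hsupp ν₀ hB₀) (hsupp ν₁ hB₁))
      _ = Metric.ediam (ι '' (ι ⁻¹' B)) := by rw [Metric.ediam_closure, hι.ediam_image]
      _ ≤ Metric.ediam B := Metric.ediam_mono (Set.image_preimage_subset _ _)
  obtain ⟨π, ⟨hπp, hgeo, hopt⟩, hbound⟩ := (hC q hq D hD).2 ν₀ ν₁ inferInstance inferInstance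
    hac₀ hac₁ (hn₀.trans_lt hK.lt_top) (hn₁.trans_lt hK.lt_top) hdiam
  have hΦ : Measurable (pushCurve hι) := (isometry_pushCurve hι).continuous.measurable
  have hmap : ∀ t, (π.map (pushCurve hι)).map (fun γ => γ t) = (π.map fun γ => γ t).map ι :=
    fun t => by
      rw [Measure.map_map (measurable_eval t) hΦ, Measure.map_map hιm (measurable_eval t)]
      rfl
  have hfst : π.map (fun γ => γ 0) = ν₀ := by
    rw [← hopt.1.2.1, Measure.map_map measurable_fst measurable_evalPair]
    rfl
  have hsnd : π.map (fun γ => γ 1) = ν₁ := by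
    rw [← hopt.1.2.2, Measure.map_map measurable_snd measurable_evalPair]
    rfl
  refine ⟨⟨π.map (pushCurve hι), Measure.isProbabilityMeasure_map hΦ.aemeasurable⟩,
    ?_, fun t => ?_, ?_, ?_, fun α hα => ?_⟩
  · have h0 : ∀ᵐ γ ∂π, ι (γ 0) ∈ B := ae_of_ae_map (measurable_eval 0).aemeasurable
      (p := fun w => ι w ∈ B) (by rw [hfst]; exact hB₀)
    have h1 : ∀ᵐ γ ∂π, ι (γ 1) ∈ B := ae_of_ae_map (measurable_eval 1).aemeasurable
      (p := fun w => ι w ∈ B) (by rw [hsnd]; exact hB₁)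
    refine (ae_map_iff hΦ.aemeasurable ?_).2 ?_
    · exact isClosed_setOf_isGeodesic.measurableSet.inter
        ((measurable_eval 0 hB).inter (measurable_eval 1 hB))
    · filter_upwards [hgeo, h0, h1] with γ hγ h0 h1
      exact ⟨(isGeodesic_pushCurve_iff hι).2 hγ, h0, h1⟩
  · have : IsProbabilityMeasure (π.map fun γ => γ t) :=
      Measure.isProbabilityMeasure_map (measurable_eval t).aemeasurable
    rw [ProbabilityMeasure.coe_mk, hmap, ← Measure.map_smul]
    refine Measure.map_mono (le_smul_of_densityNorm_le (hbound t).1 ((hbound t).2.trans ?_)) hιm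
    gcongr
    exact max_le hn₀ hn₁
  · rw [ProbabilityMeasure.coe_mk, hmap, hfst]
  · rw [ProbabilityMeasure.coe_mk, hmap, hsnd]
  · have h := hopt.2 α hα
    have hmeas : Measurable fun γ : Curve Z => edist (γ 0) (γ 1) ^ q :=
      (show Measurable fun z : Z × Z => edist z.1 z.2 ^ q by fun_prop).comp measurable_evalPair
    rw [ProbabilityMeasure.coe_mk, lintegral_map hmeas hΦ,
      lintegral_map (by fun_prop) (hιm.prodMap hιm)]
    simp only [cost, lintegral_map (f := fun z : X × X => edist z.1 z.2 ^ q) (by fun_prop)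
      (measurable_evalPair (Z := X))] at h
    simpa [hι.edist_eq] using h

theorem dist_lt_of_ediam_lt {Z : Type*} [MetricSpace Z] {B : Set Z} {D : ℝ}
    (hBD : Metric.ediam B < ENNReal.ofReal D) {x y : Z} (hx : x ∈ B) (hy : y ∈ B) :
    dist x y < D := by
  have h := (Metric.edist_le_ediam_of_mem hx hy).trans_lt hBD
  rw [edist_dist] at h
  exact (ENNReal.ofReal_lt_ofReal_iff_of_nonneg dist_nonneg).1 h

/-! ### Approximating dynamical plans -/

/-- Along a converging sequence of spaces with the bounded interpolation property, the transport
problem of the limit space is approximated by dynamical optimal plans with bounded density. -/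
theorem exists_approximating_plan {X : ℕ → Type u} [∀ n, MetricSpace (X n)]
    [∀ n, SecondCountableTopology (X n)] [∀ n, MeasurableSpace (X n)] [∀ n, BorelSpace (X n)]
    {Y : Type v} [MetricSpace Y] [MeasurableSpace Y] [BorelSpace Y]
    {Z : Type w} [MetricSpace Z] [SecondCountableTopology Z] [MeasurableSpace Z] [BorelSpace Z]
    {ι : ∀ n, X n → Z} (hι : ∀ n, Isometry (ι n)) {ιY : Y → Z} (hιY : Isometry ιY)
    {m : ∀ n, Measure (X n)} [∀ n, SigmaFinite (m n)] [∀ n, Nonempty (X n)]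
    {mY : Measure Y} [SigmaFinite mY] {Cn : ℕ → ℝ → ℝ → ℝ} (hBIP : ∀ n, HasBIP (m n) (Cn n))
    {q D : ℝ} (hq : 1 < q) (hD : 0 < D) {B : Set Z} (hB : MeasurableSet B)
    (hBD : Metric.ediam B < ENNReal.ofReal D) (hBfr : mY.map ιY (frontier B) = 0)
    (hfin : ∀ n, m n (ι n ⁻¹' B) < ⊤)
    {l : ℕ → FiniteMeasure Z} {l' : FiniteMeasure Z} (hl : Tendsto l atTop (𝓝 l')) (hl0 : l' ≠ 0)
    (hml : ∀ n, ((m n).map (ι n)).restrict (Metric.thickening D B) ≤ l n)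
    (hlm : ∀ n, (l n : Measure Z) ≤ (m n).map (ι n))
    (hml' : (mY.map ιY).restrict (Metric.thickening D B) ≤ l')
    (hlm' : (l' : Measure Z) ≤ mY.map ιY)
    {μ₀ μ₁ : Measure Y} [IsProbabilityMeasure μ₀] [IsProbabilityMeasure μ₁] {K : ℝ≥0}
    (hK₀ : μ₀ ≤ K • mY) (hK₁ : μ₁ ≤ K • mY)
    (hB₀ : ∀ᵐ y ∂μ₀, ιY y ∈ B) (hB₁ : ∀ᵐ y ∂μ₁, ιY y ∈ B)
    {c : ℝ} (hc : ∀ᶠ n in atTop, Cn n q D ≤ c) {η : ℝ≥0} (hη : 0 < η) (k : ℕ) :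
    ∃ n ≥ k, ∃ p : ProbabilityMeasure (Curve Z),
      (∀ᵐ γ ∂(p : Measure (Curve Z)), IsGeodesic γ ∧ γ 0 ∈ B ∧ γ 1 ∈ B) ∧
      (∀ t, (p : Measure (Curve Z)).map (fun γ => γ t) ≤
        (c.toNNReal * ((1 + η) * K)) • (l n : Measure Z)) ∧
      ∀ β, IsCoupling μ₀ μ₁ β → ∃ α : ProbabilityMeasure (Z × Z),
        (α : Measure (Z × Z)).map Prod.fst = (p : Measure (Curve Z)).map (fun γ => γ 0) ∧
        (α : Measure (Z × Z)).map Prod.snd = (p : Measure (Curve Z)).map (fun γ => γ 1) ∧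
        (∀ᵐ z ∂(α : Measure (Z × Z)), z.1 ∈ B ∧ z.2 ∈ B) ∧
        ∫⁻ γ, edist (γ 0) (γ 1) ^ q ∂(p : Measure (Curve Z)) ≤
          ∫⁻ z, edist z.1 z.2 ^ q ∂(α : Measure (Z × Z)) ∧
        ∀ (f : Z × Z → ℝ) (M : ℝ) (L : ℝ≥0), (∀ x, |f x| ≤ M) → LipschitzWith L f →
          |∫ z, f z ∂(α : Measure (Z × Z)) - ∫ z, f z ∂(β.map (Prod.map ιY ιY))| ≤
            (L + 4 * M) * η := by
  have hιm : ∀ n, Measurable (ι n) := fun n => (hι n).continuous.measurable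
  have hιYm : Measurable ιY := hιY.continuous.measurable
  have hηr : (0 : ℝ) < η := hη
  -- Using the sum of the two measures makes the residual cell small for both.
  obtain ⟨N, A, hA, hd, hAB, hAfr, hdiam, hnone⟩ := exists_cells (mY.map ιY)
    (μ₀.map ιY + μ₁.map ιY) hB hBfr hηr
  have hAsub : ∀ i, A i ⊆ B := fun i => hAB ▸ Set.subset_iUnion A i
  have hBthick : B ⊆ Metric.thickening D B := Metric.self_subset_thickening hD B
  -- Cell masses converge because the boundaries are negligible. The factor `1 + η` turns the limit
  -- into a strict inequality on charged cells; null cells are trivial.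
  have hcell : ∀ᶠ n in atTop, ∀ i, mY (ιY ⁻¹' A i) ≤ (1 + η) * m n (ι n ⁻¹' A i) := by
    refine eventually_all.2 fun i => ?_
    have hle : mY (ιY ⁻¹' A i) ≤ (l' : Measure Z) (A i) := by
      rw [← Measure.map_apply hιYm (hA i)]
      calc mY.map ιY (A i) = (mY.map ιY).restrict (Metric.thickening D B) (A i) := by
            rw [Measure.restrict_apply (hA i),
              Set.inter_eq_self_of_subset_left ((hAsub i).trans hBthick)]
        _ ≤ _ := hml' _
    rcases eq_or_ne ((l' : Measure Z) (A i)) 0 with h0 | h0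
    · exact Eventually.of_forall fun n => by simp [le_antisymm (hle.trans h0.le) zero_le]
    have hlim := tendsto_finiteMeasure_of_null_frontier hl hl0 (A := A i)
      (le_antisymm ((hlm' _).trans (hAfr i).le) zero_le)
    have hlim' := ENNReal.Tendsto.const_mul (a := 1 + (η : ℝ≥0∞)) hlim (Or.inr (by simp))
    have hlt : (l' : Measure Z) (A i) < (1 + (η : ℝ≥0∞)) * (l' : Measure Z) (A i) := by
      rw [add_mul, one_mul]
      exact ENNReal.lt_add_right (measure_ne_top _ _) (mul_ne_zero (by simpa using hη.ne') h0)
    filter_upwards [hlim'.eventually_const_lt hlt] with n hn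
    refine hle.trans (hn.le.trans ?_)
    gcongr
    rw [← Measure.map_apply (hιm n) (hA i)]
    exact hlm n _
  obtain ⟨n, ⟨hcn, hcelln⟩, hkn⟩ := ((hc.and hcell).and (eventually_ge_atTop k)).exists
  have hKi : ∀ μ : Measure Y, μ ≤ K • mY → ∀ i, μ (ιY ⁻¹' A i) ≤
      ((1 + η) * K : ℝ≥0) * m n (ι n ⁻¹' A i) := fun μ hμ i => by
    refine (hμ _).trans ?_
    rw [Measure.smul_apply, ENNReal.smul_def, smul_eq_mul]
    calc (K : ℝ≥0∞) * mY (ιY ⁻¹' A i) ≤ K * ((1 + η) * m n (ι n ⁻¹' A i)) := by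
          gcongr; exact hcelln i
      _ = _ := by push_cast; ring
  have hnone' : μ₀ (ιY ⁻¹' A none) + μ₁ (ιY ⁻¹' A none) ≤ ENNReal.ofReal η := by
    rwa [Measure.add_apply, Measure.map_apply hιYm (hA _), Measure.map_apply hιYm (hA _)] at hnone
  obtain ⟨ν₀, ν₁, hν₀p, hν₁p, hν₀K, hν₁K, hν₀B, hν₁B, htransfer⟩ := exists_transfer hιYm (hιm n)
    hA hd hAB hηr hdiam
    (fun i => ((measure_mono (Set.preimage_mono (hAsub i))).trans_lt (hfin n)).ne)
    hB₀ hB₁ (le_self_add.trans hnone') (le_add_self.trans hnone') (hKi μ₀ hK₀) (hKi μ₁ hK₁)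
  obtain ⟨p, hpgeo, hpt, hp0, hp1, hpcost⟩ := (hBIP n).exists_ambient_plan (hι n) hq hD hB hBD
    ENNReal.coe_ne_top hν₀K hν₁K hν₀B hν₁B
  refine ⟨n, hkn, p, hpgeo, fun t => ?_, fun β hβ => ?_⟩
  -- A geodesic with endpoints in `B` stays within distance `D` of its starting point, hence in the
  -- region where `l n` dominates the reference measure.
  · have hmem : ∀ᵐ z ∂(p : Measure (Curve Z)).map (fun γ => γ t), z ∈ Metric.thickening D B := by
      refine (ae_map_iff (measurable_eval t).aemeasurable
        Metric.isOpen_thickening.measurableSet).2 ?_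
      filter_upwards [hpgeo] with γ hγ
      refine Metric.mem_thickening_iff.2 ⟨γ 0, hγ.2.1, ?_⟩
      rw [hγ.1 t 0]
      calc |((0 : unitInterval) : ℝ) - t| * dist (γ 0) (γ 1) ≤ 1 * dist (γ 0) (γ 1) := by
            gcongr
            rw [Set.Icc.coe_zero, zero_sub, abs_neg, abs_of_nonneg t.2.1]
            exact t.2.2
        _ < D := by rw [one_mul]; exact dist_lt_of_ediam_lt hBD hγ.2.1 hγ.2.2
    rw [← Measure.restrict_eq_self_of_ae_mem hmem]
    refine (Measure.restrict_mono le_rfl (hpt t)).trans ?_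
    rw [Measure.restrict_smul]
    refine Measure.le_iff.2 fun s _ => ?_
    simp only [Measure.smul_apply, ENNReal.smul_def, smul_eq_mul, ENNReal.coe_mul]
    gcongr
    · exact ENNReal.ofReal_le_ofReal hcn
    · exact hml n
  · obtain ⟨α, hα, hαf⟩ := htransfer β hβ
    have hαp := hα.1
    have hmm : Measurable (Prod.map (ι n) (ι n)) := (hιm n).prodMap (hιm n)
    refine ⟨⟨α.map (Prod.map (ι n) (ι n)), Measure.isProbabilityMeasure_map hmm.aemeasurable⟩,
      ?_, ?_, ?_, hpcost α hα, fun f M L hM hL => ?_⟩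
    · rw [hp0, ← hα.2.1, ProbabilityMeasure.coe_mk, Measure.map_map measurable_fst hmm,
        Measure.map_map (hιm n) measurable_fst]
      rfl
    · rw [hp1, ← hα.2.2, ProbabilityMeasure.coe_mk, Measure.map_map measurable_snd hmm,
        Measure.map_map (hιm n) measurable_snd]
      rfl
    · refine (ae_map_iff hmm.aemeasurable ((measurable_fst hB).inter (measurable_snd hB))).2 ?_
      have h0 : ∀ᵐ w ∂α, ι n w.1 ∈ B := ae_of_ae_map measurable_fst.aemeasurable
        (p := fun w => ι n w ∈ B) (by rw [hα.2.1]; exact hν₀B)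
      have h1 : ∀ᵐ w ∂α, ι n w.2 ∈ B := ae_of_ae_map measurable_snd.aemeasurable
        (p := fun w => ι n w ∈ B) (by rw [hα.2.2]; exact hν₁B)
      filter_upwards [h0, h1] with w h0 h1 using ⟨h0, h1⟩
    · rw [ProbabilityMeasure.coe_mk, integral_map hmm.aemeasurable
        hL.continuous.aestronglyMeasurable, integral_map (hιYm.prodMap hιYm).aemeasurable
        hL.continuous.aestronglyMeasurable]
      exact hαf f M L hM hL

/-! ### Passage to the limit and descent to the limit space -/

/-- The `q`-th power of the distance truncated at `R`, as a bounded continuous function. -/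
noncomputable def truncatedCost (Z : Type*) [MetricSpace Z] (R : ℝ≥0) {q : ℝ} (hq : 0 < q) :
    Z × Z →ᵇ ℝ≥0 :=
  BoundedContinuousFunction.mkOfBound
    ⟨fun z => min (nndist z.1 z.2) R ^ q, by
      have : Continuous fun z : Z × Z => min (nndist z.1 z.2) R := by fun_prop
      exact (NNReal.continuous_rpow_const hq.le).comp this⟩ (R ^ q : ℝ≥0) fun x y => by
      have h : ∀ z : Z × Z, min (nndist z.1 z.2) R ^ q ≤ R ^ q := fun z =>
        NNReal.rpow_le_rpow (min_le_right _ _) hq.le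
      rw [NNReal.dist_eq]
      exact abs_sub_le_of_nonneg_of_le (NNReal.coe_nonneg _) (NNReal.coe_le_coe.2 (h x))
        (NNReal.coe_nonneg _) (NNReal.coe_le_coe.2 (h y))

theorem coe_truncatedCost_le {Z : Type*} [MetricSpace Z] {R : ℝ≥0} {q : ℝ} (hq : 0 < q)
    (z : Z × Z) : (truncatedCost Z R hq z : ℝ≥0∞) ≤ edist z.1 z.2 ^ q := by
  change ((min (nndist z.1 z.2) R ^ q : ℝ≥0) : ℝ≥0∞) ≤ _
  rw [edist_nndist, ← ENNReal.coe_rpow_of_nonneg _ hq.le]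
  exact ENNReal.coe_le_coe.2 (NNReal.rpow_le_rpow (min_le_left _ _) hq.le)

theorem coe_truncatedCost_eq {Z : Type*} [MetricSpace Z] {R : ℝ≥0} {q : ℝ} (hq : 0 < q)
    {z : Z × Z} (hz : nndist z.1 z.2 ≤ R) :
    (truncatedCost Z R hq z : ℝ≥0∞) = edist z.1 z.2 ^ q := by
  change ((min (nndist z.1 z.2) R ^ q : ℝ≥0) : ℝ≥0∞) = _
  rw [edist_nndist, ← ENNReal.coe_rpow_of_nonneg _ hq.le, min_eq_left hz]

/-- Dynamical plans that compete with approximations of all the plans in `S` subconverge to a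
dynamical plan that competes with all the plans in `S`. -/
theorem exists_limit_plan {Z : Type*} [MetricSpace Z] [CompleteSpace Z]
    [SecondCountableTopology Z] [MeasurableSpace Z] [BorelSpace Z]
    {l : ℕ → FiniteMeasure Z} {l' : FiniteMeasure Z} (hl : Tendsto l atTop (𝓝 l')) (hl0 : l' ≠ 0)
    {q D : ℝ} (hq : 0 < q) {B : Set Z} (hBD : Metric.ediam B < ENNReal.ofReal D)
    {p : ℕ → ProbabilityMeasure (Curve Z)}
    (hgeo : ∀ k, ∀ᵐ γ ∂(p k : Measure (Curve Z)), IsGeodesic γ ∧ γ 0 ∈ B ∧ γ 1 ∈ B)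
    {c : ℕ → ℝ≥0} {c' : ℝ≥0} (hc : Tendsto c atTop (𝓝 c'))
    (hle : ∀ k t, (p k : Measure (Curve Z)).map (fun γ => γ t) ≤ c k • (l k : Measure Z))
    {η : ℕ → ℝ≥0} (hη : Tendsto η atTop (𝓝 0)) {S : Set (ProbabilityMeasure (Z × Z))}
    (hS : ∀ β ∈ S, ∀ k, ∃ α : ProbabilityMeasure (Z × Z),
      (α : Measure (Z × Z)).map Prod.fst = (p k : Measure (Curve Z)).map (fun γ => γ 0) ∧
      (α : Measure (Z × Z)).map Prod.snd = (p k : Measure (Curve Z)).map (fun γ => γ 1) ∧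
      (∀ᵐ z ∂(α : Measure (Z × Z)), z.1 ∈ B ∧ z.2 ∈ B) ∧
      ∫⁻ γ, edist (γ 0) (γ 1) ^ q ∂(p k : Measure (Curve Z)) ≤
        ∫⁻ z, edist z.1 z.2 ^ q ∂(α : Measure (Z × Z)) ∧
      ∀ (f : Z × Z → ℝ) (M : ℝ) (L : ℝ≥0), (∀ x, |f x| ≤ M) → LipschitzWith L f →
        |∫ z, f z ∂(α : Measure (Z × Z)) - ∫ z, f z ∂(β : Measure (Z × Z))| ≤
          (L + 4 * M) * η k) :
    ∃ p' : ProbabilityMeasure (Curve Z), (∀ᵐ γ ∂(p' : Measure (Curve Z)), IsGeodesic γ) ∧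
      (∀ t, (p' : Measure (Curve Z)).map (fun γ => γ t) ≤ c' • (l' : Measure Z)) ∧
      ∀ β ∈ S, (p' : Measure (Curve Z)).map (fun γ => γ 0) = (β : Measure (Z × Z)).map Prod.fst ∧
        (p' : Measure (Curve Z)).map (fun γ => γ 1) = (β : Measure (Z × Z)).map Prod.snd ∧
        ∫⁻ γ, edist (γ 0) (γ 1) ^ q ∂(p' : Measure (Curve Z)) ≤
          ∫⁻ z, edist z.1 z.2 ^ q ∂(β : Measure (Z × Z)) := by
  obtain ⟨cmax, hcmax⟩ := hc.bddAbove_range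
  have hle' : ∀ k t, (p k : Measure (Curve Z)).map (fun γ => γ t) ≤ cmax • (l k : Measure Z) :=
    fun k t => (hle k t).trans (Measure.le_iff.2 fun s _ => by
      simp only [Measure.smul_apply, ENNReal.smul_def, smul_eq_mul]
      gcongr
      exact hcmax ⟨k, rfl⟩)
  have hgeoD : ∀ k, ∀ᵐ γ ∂(p k : Measure (Curve Z)), IsGeodesic γ ∧ dist (γ 0) (γ 1) ≤ D :=
    fun k => (hgeo k).mono fun γ hγ => ⟨hγ.1, (dist_lt_of_ediam_lt hBD hγ.2.1 hγ.2.2).le⟩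
  obtain ⟨p', φ, hφ, hp'⟩ := exists_subseq_tendsto_of_marginals_le hl hl0 p D hgeoD hle'
  have hevalc : ∀ t : unitInterval, Continuous fun γ : Curve Z => γ t :=
    fun t => continuous_eval_const t
  have hφt := hφ.tendsto_atTop
  have hgeo' : ∀ᵐ γ ∂(p' : Measure (Curve Z)), γ ∈ {γ : Curve Z | IsGeodesic γ} ∩
      {γ : Curve Z | dist (γ 0) (γ 1) ≤ D} :=
    ae_of_tendsto_of_isClosed hp' (isClosed_setOf_isGeodesic.inter
      (isClosed_le ((hevalc 0).dist (hevalc 1)) continuous_const)) fun k => hgeoD (φ k)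
  have hmapt : ∀ t, Tendsto (fun k => (p (φ k)).map (hevalc t).measurable.aemeasurable) atTop
      (𝓝 (p'.map (hevalc t).measurable.aemeasurable)) := fun t =>
    ProbabilityMeasure.tendsto_map_of_tendsto_of_continuous _ _ hp' (hevalc t)
  refine ⟨p', hgeo'.mono fun γ hγ => hγ.1, fun t => ?_, fun β hβ => ?_⟩
  · exact le_smul_of_tendsto (hmapt t) (hl.comp hφt) (hc.comp hφt) fun k => hle (φ k) t
  choose α hα0 hα1 hαB hαcost hαf using hS β hβ
  -- Bounded Lipschitz functions determine weak convergence. The sup bound for `f` comes from its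
  -- value at one point and its oscillation `b`.
  have hlim : Tendsto α atTop (𝓝 β) := by
    rw [tendsto_iff_forall_lipschitz_integral_tendsto]
    rintro f ⟨b, hb⟩ ⟨L, hL⟩
    obtain ⟨x⟩ : Nonempty (Z × Z) := nonempty_of_isProbabilityMeasure (β : Measure (Z × Z))
    have hM : ∀ y, |f y| ≤ |f x| + b := fun y => by
      have h1 := hb y x
      rw [Real.dist_eq] at h1
      linarith [abs_sub_abs_le_abs_sub (f y) (f x)]
    refine tendsto_iff_dist_tendsto_zero.2 (squeeze_zero (fun _ => dist_nonneg)
      (fun k => hαf k f _ L hM hL) ?_)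
    have := (NNReal.tendsto_coe.2 hη).const_mul (L + 4 * (|f x| + b))
    simpa using this
  have hlimφ := hlim.comp hφt
  -- `α k` and `p k` share their endpoint marginals, so the limits do too, by uniqueness of weak
  -- limits.
  have hmarg : ∀ (t : unitInterval) (g : Z × Z → Z) (hg : Continuous g),
      (∀ k, (α k : Measure (Z × Z)).map g = (p k : Measure (Curve Z)).map (fun γ => γ t)) →
      (p' : Measure (Curve Z)).map (fun γ => γ t) = (β : Measure (Z × Z)).map g := by
    intro t g hg h
    have h1 := ProbabilityMeasure.tendsto_map_of_tendsto_of_continuous _ _ hlimφ hg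
    have h2 : (fun k => ((α ∘ φ) k).map hg.measurable.aemeasurable) =
        fun k => (p (φ k)).map (hevalc t).measurable.aemeasurable :=
      funext fun k => Subtype.ext (h (φ k))
    rw [h2] at h1
    exact congrArg (fun μ : ProbabilityMeasure Z => (μ : Measure Z))
      (tendsto_nhds_unique (hmapt t) h1)
  refine ⟨hmarg 0 _ continuous_fst hα0, hmarg 1 _ continuous_snd hα1, ?_⟩
  -- Truncation at `D` does not change the cost for `p'` or the `α k`, whose pairs are at distance
  -- at most `D`. For `β` the truncated cost is simply smaller.
  set h := truncatedCost Z D.toNNReal hq with hh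
  have hD' : ∀ {x y : Z}, dist x y ≤ D → nndist x y ≤ D.toNNReal := fun {x y} hxy =>
    NNReal.coe_le_coe.1 (hxy.trans (Real.le_coe_toNNReal D))
  have hpair : Continuous fun γ : Curve Z => (γ 0, γ 1) := (hevalc 0).prodMk (hevalc 1)
  have hL := ProbabilityMeasure.tendsto_iff_forall_lintegral_tendsto.1 hp'
    (h.compContinuous ⟨_, hpair⟩)
  have hR := ProbabilityMeasure.tendsto_iff_forall_lintegral_tendsto.1 hlimφ h
  calc ∫⁻ γ, edist (γ 0) (γ 1) ^ q ∂(p' : Measure (Curve Z))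
      = ∫⁻ γ, (h.compContinuous ⟨_, hpair⟩ γ : ℝ≥0∞) ∂(p' : Measure (Curve Z)) :=
        lintegral_congr_ae (hgeo'.mono fun γ hγ =>
          (coe_truncatedCost_eq hq (z := (γ 0, γ 1)) (hD' hγ.2)).symm)
    _ ≤ ∫⁻ z, (h z : ℝ≥0∞) ∂(β : Measure (Z × Z)) := by
        refine le_of_tendsto_of_tendsto' hL hR fun k => ?_
        calc _ ≤ ∫⁻ γ, edist (γ 0) (γ 1) ^ q ∂(p (φ k) : Measure (Curve Z)) :=
              lintegral_mono fun γ => coe_truncatedCost_le hq (γ 0, γ 1)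
          _ ≤ ∫⁻ z, edist z.1 z.2 ^ q ∂(α (φ k) : Measure (Z × Z)) := hαcost (φ k)
          _ = _ := lintegral_congr_ae ((hαB (φ k)).mono fun z hz =>
              (coe_truncatedCost_eq hq (hD' (dist_lt_of_ediam_lt hBD hz.1 hz.2).le)).symm)
    _ ≤ _ := lintegral_mono fun z => coe_truncatedCost_le hq z

/-- A dynamical plan in an ambient space whose marginals live on an isometrically embedded complete
space comes from a dynamical plan in that space. -/
theorem exists_isOptGeo_of_ambient {Y : Type v} {Z : Type*} [MetricSpace Y] [CompleteSpace Y]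
    [SecondCountableTopology Y] [MeasurableSpace Y] [BorelSpace Y] [MetricSpace Z]
    [SecondCountableTopology Z] [MeasurableSpace Z] [BorelSpace Z] {ι : Y → Z} (hι : Isometry ι)
    {m μ₀ μ₁ : Measure Y} {q : ℝ}
    {p : Measure (Curve Z)} [IsProbabilityMeasure p]
    (hgeo : ∀ᵐ γ ∂p, IsGeodesic γ) {c : ℝ≥0}
    (hle : ∀ t, p.map (fun γ => γ t) ≤ c • m.map ι)
    (h0 : p.map (fun γ => γ 0) = μ₀.map ι) (h1 : p.map (fun γ => γ 1) = μ₁.map ι)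
    (hcost : ∀ β, IsCoupling μ₀ μ₁ β → ∫⁻ γ, edist (γ 0) (γ 1) ^ q ∂p ≤ cost q β) :
    ∃ π : Measure (Curve Y), IsOptGeo q μ₀ μ₁ π ∧ ∀ t, π.map (fun γ => γ t) ≤ c • m := by
  have hιe : MeasurableEmbedding ι := hι.isClosedEmbedding.measurableEmbedding
  have hΦ := measurableEmbedding_pushCurve hι
  have hrange : IsClosed (Set.range ι) := hι.isClosedEmbedding.isClosed_range
  have hmem : ∀ᵐ γ ∂p, γ ∈ Set.range (pushCurve hι) := by
    have ht : ∀ t : unitInterval, ∀ᵐ γ ∂p, γ t ∈ Set.range ι := fun t => by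
      refine ae_of_ae_map (measurable_eval t).aemeasurable (p := fun z => z ∈ Set.range ι) ?_
      refine le_antisymm ((hle t _).trans_eq ?_) zero_le
      rw [Measure.smul_apply, hιe.map_apply]
      have : ι ⁻¹' {z | z ∈ Set.range ι}ᶜ = ∅ := by ext; simp
      rw [this, measure_empty, smul_zero]
    -- Almost every curve lies in the closed range of `ι` at countably many dense times, hence at
    -- all times by continuity.
    have hT := TopologicalSpace.denseRange_denseSeq unitInterval
    filter_upwards [ae_all_iff.2 fun k => ht (TopologicalSpace.denseSeq unitInterval k)] with γ hγ
    rw [mem_range_pushCurve_iff]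
    exact fun t => hT.induction_on (p := fun t => γ t ∈ Set.range ι) t
      (hrange.preimage γ.continuous) hγ
  have hmap : (p.comap (pushCurve hι)).map (pushCurve hι) = p := by
    rw [hΦ.map_comap, Measure.restrict_eq_self_of_ae_mem hmem]
  set π := p.comap (pushCurve hι) with hπ
  have hmapt : ∀ t, (π.map fun γ => γ t).map ι = p.map fun γ => γ t := fun t => by
    rw [← hmap, Measure.map_map (measurable_eval t) hΦ.measurable,
      Measure.map_map hιe.measurable (measurable_eval t)]
    rfl
  have hinj : ∀ {a b : Measure Y}, a.map ι = b.map ι → a = b := fun {a b} hab => by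
    rw [← hιe.comap_map a, ← hιe.comap_map b, hab]
  have hπp : IsProbabilityMeasure π := by
    have : IsProbabilityMeasure (π.map (pushCurve hι)) := by rwa [hmap]
    exact Measure.isProbabilityMeasure_of_map (pushCurve hι)
  refine ⟨π, ⟨hπp, ?_, ⟨Measure.isProbabilityMeasure_map measurable_evalPair.aemeasurable, ?_, ?_⟩,
    fun β hβ => ?_⟩, fun t => ?_⟩
  · rw [← hmap] at hgeo
    exact (ae_of_ae_map hΦ.measurable.aemeasurable hgeo).mono fun γ hγ =>
      (isGeodesic_pushCurve_iff hι).1 hγ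
  · rw [Measure.map_map measurable_fst measurable_evalPair]
    exact hinj ((hmapt 0).trans h0)
  · rw [Measure.map_map measurable_snd measurable_evalPair]
    exact hinj ((hmapt 1).trans h1)
  · refine le_trans (le_of_eq ?_) (hcost β hβ)
    rw [cost, lintegral_map (by fun_prop) measurable_evalPair, ← hmap, hΦ.lintegral_map]
    simp [hι.edist_eq]
  · refine Measure.le_iff.2 fun s hs => ?_
    have h2 := hle t (ι '' s)
    rw [← hmapt t, hιe.map_apply, Measure.smul_apply, hιe.map_apply,
      Set.preimage_image_eq _ hι.injective] at h2
    exact h2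

end BIP

/-! ### The stability theorem -/

theorem mainTheorem2
    {X : ℕ → Type u} [∀ n, MetricSpace (X n)] [∀ n, CompleteSpace (X n)]
    [∀ n, TopologicalSpace.SeparableSpace (X n)]
    [∀ n, MeasurableSpace (X n)] [∀ n, BorelSpace (X n)]
    {Xinf : Type v} [MetricSpace Xinf] [CompleteSpace Xinf]
    [TopologicalSpace.SeparableSpace Xinf]
    [MeasurableSpace Xinf] [BorelSpace Xinf]
    (m : ∀ n, Measure (X n)) (hm : ∀ n, BIP.IsReferenceMeasure (m n)) (x : ∀ n, X n)
    (minf : Measure Xinf) (hminf : BIP.IsReferenceMeasure minf) (xinf : Xinf)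
    (hconv : BIP.PMGHConverges.{u, v, w} m x minf xinf)
    (Cn : ℕ → ℝ → ℝ → ℝ) (hBIP : ∀ n, BIP.HasBIP (m n) (Cn n))
    (C : ℝ → ℝ → ℝ)
    (hC : ∀ q : ℝ, 1 < q → ∀ D : ℝ, 0 < D →
      limsup (fun n => ((Cn n q D : ℝ) : EReal)) atTop ≤ ((C q D : ℝ) : EReal)) :
    BIP.HasBIP minf C := by
  obtain ⟨Z, _, _, _, _, _, ι, ιY, hι, hιY, -, hconv⟩ := hconv
  have hZ2 : SecondCountableTopology Z := UniformSpace.secondCountable_of_separable Z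
  have hY2 : SecondCountableTopology Xinf := UniformSpace.secondCountable_of_separable Xinf
  have hX2 : ∀ n, SecondCountableTopology (X n) := fun n =>
    UniformSpace.secondCountable_of_separable (X n)
  have hXne : ∀ n, Nonempty (X n) := fun n => ⟨x n⟩
  have hσ : ∀ n, SigmaFinite (m n) := fun n => (hm n).sigmaFinite (x n)
  have hσ' : SigmaFinite minf := hminf.sigmaFinite xinf
  have hιYm : Measurable ιY := hιY.continuous.measurable
  intro q hq D hD
  have hC1 : 1 ≤ C q D := by
    rw [← EReal.coe_le_coe_iff]
    refine le_trans ?_ (hC q hq D hD)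
    refine le_limsup_of_frequently_le (Frequently.of_forall fun n => ?_)
    exact EReal.coe_le_coe_iff.2 (hBIP n q hq D hD).1
  refine ⟨hC1, fun μ₀ μ₁ hp₀ hp₁ hac₀ hac₁ hn₀ hn₁ hdiam => ?_⟩
  set S := μ₀.support ∪ μ₁.support with hS
  obtain ⟨B, hBo, hSB, hBD, hBfr⟩ : ∃ B : Set Z, IsOpen B ∧ ιY '' S ⊆ B ∧
      Metric.ediam B < ENNReal.ofReal D ∧ minf.map ιY (frontier B) = 0 := by
    -- The strict inequality for the diameter leaves room for an `ε`-thickening, which adds at most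
    -- `2 * ε`; a smaller generic radius makes the boundary negligible.
    obtain ⟨ε, hε0, hε⟩ := ENNReal.exists_nnreal_pos_mul_lt (a := 2)
      (b := ENNReal.ofReal D - Metric.ediam S) (by simp) (tsub_pos_of_lt hdiam).ne'
    obtain ⟨r, hr, hfr⟩ := exists_null_frontier_thickening (minf.map ιY) (ιY '' S)
      (NNReal.coe_pos.2 hε0)
    refine ⟨_, Metric.isOpen_thickening, Metric.self_subset_thickening hr.1 _, ?_, hfr⟩
    calc Metric.ediam (Metric.thickening r (ιY '' S))
        ≤ Metric.ediam (Metric.thickening ε (ιY '' S)) :=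
          Metric.ediam_mono (Metric.thickening_mono hr.2.le _)
      _ ≤ Metric.ediam S + 2 * ε := by
          rw [← hιY.ediam_image S]; exact Metric.ediam_thickening_le ε
      _ < ENNReal.ofReal D := by
          rw [mul_comm, add_comm]
          exact lt_tsub_iff_right.1 hε
  have hBbdd : Bornology.IsBounded B :=
    Metric.isBounded_iff_ediam_ne_top.2 (hBD.trans ENNReal.ofReal_lt_top).ne
  have hB₀ : ∀ᵐ y ∂μ₀, ιY y ∈ B :=
    mem_of_superset Measure.support_mem_ae fun y hy => hSB ⟨y, Or.inl hy, rfl⟩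
  have hB₁ : ∀ᵐ y ∂μ₁, ιY y ∈ B :=
    mem_of_superset Measure.support_mem_ae fun y hy => hSB ⟨y, Or.inr hy, rfl⟩
  have hfin : ∀ n (s : Set Z), Bornology.IsBounded s → (m n).map (ι n) s < ⊤ := fun n s hs => by
    rw [(hι n).isClosedEmbedding.measurableEmbedding.map_apply]
    exact (hm n).finite_of_bounded _ ((hι n).antilipschitz.isBounded_preimage hs)
  have hfin' : ∀ s : Set Z, Bornology.IsBounded s → minf.map ιY s < ⊤ := fun s hs => by
    rw [hιY.isClosedEmbedding.measurableEmbedding.map_apply]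
    exact hminf.finite_of_bounded _ (hιY.antilipschitz.isBounded_preimage hs)
  obtain ⟨l, l', hl, hml, hlm, hml', hlm'⟩ := BIP.exists_finiteMeasure_cutoff hfin hfin' hconv
    (hBbdd.thickening (δ := D))
  have hBsub : B ⊆ Metric.thickening D B := Metric.self_subset_thickening hD B
  -- Otherwise `B` would be null for the limit measure, hence for `μ₀`, which is carried by `B`.
  have hl0 : l' ≠ 0 := by
    rintro rfl
    have h1 : minf.map ιY B = 0 := by
      have := hml' B
      rwa [Measure.restrict_apply hBo.measurableSet, Set.inter_eq_self_of_subset_left hBsub,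
        FiniteMeasure.toMeasure_zero, Measure.coe_zero, Pi.zero_apply, nonpos_iff_eq_zero] at this
    rw [Measure.map_apply hιYm hBo.measurableSet] at h1
    have h2 : ∀ᵐ y ∂μ₀, ιY y ∉ B := by
      rw [ae_iff]
      simp only [not_not]
      exact hac₀ h1
    obtain ⟨y, hy, hy'⟩ := (hB₀.and h2).exists
    exact hy' hy
  obtain ⟨K, hK⟩ : ∃ K : NNReal, (K : ENNReal) = max (BIP.densityNorm minf μ₀) (BIP.densityNorm minf μ₁) :=
    ⟨_, ENNReal.coe_toNNReal (max_lt hn₀ hn₁).ne⟩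
  have hK₀ : μ₀ ≤ K • minf := BIP.le_smul_of_densityNorm_le hac₀ (hK ▸ le_max_left _ _)
  have hK₁ : μ₁ ≤ K • minf := BIP.le_smul_of_densityNorm_le hac₁ (hK ▸ le_max_right _ _)
  let η : ℕ → NNReal := fun k => 1 / ((k : NNReal) + 1)
  have hη0 : ∀ k, 0 < η k := fun k => by positivity
  have hη : Tendsto η atTop (𝓝 0) := tendsto_one_div_add_atTop_nhds_zero_nat
  have hCev : ∀ k, ∀ᶠ n in atTop, Cn n q D ≤ C q D + η k := fun k => by
    have hlt : limsup (fun n => ((Cn n q D : ℝ) : EReal)) atTop < ((C q D + η k : ℝ) : EReal) :=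
      (hC q hq D hD).trans_lt (EReal.coe_lt_coe_iff.2 (lt_add_of_pos_right _ (hη0 k)))
    exact (eventually_lt_of_limsup_lt hlt).mono fun n hn => (EReal.coe_lt_coe_iff.1 hn).le
  -- Diagonal choice: the `k`-th plan has error `η k` and lives on the space of index `n k ≥ k`. The
  -- constants then tend to `C q D * K`.
  choose n hn p hpgeo hple hpα using fun k => BIP.exists_approximating_plan hι hιY hBIP hq hD
    hBo.measurableSet hBD hBfr
    (fun n => (hm n).finite_of_bounded _ ((hι n).antilipschitz.isBounded_preimage hBbdd))
    hl hl0 hml hlm hml' hlm' hK₀ hK₁ hB₀ hB₁ (hCev k) (hη0 k) k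
  have hnt : Tendsto n atTop atTop := tendsto_atTop_mono hn tendsto_id
  have hct : Tendsto (fun k => (C q D + η k).toNNReal * ((1 + η k) * K)) atTop
      (𝓝 ((C q D).toNNReal * K)) := by
    have h1 : Tendsto (fun k => (C q D + η k).toNNReal) atTop (𝓝 (C q D).toNNReal) := by
      have := (NNReal.tendsto_coe.2 hη).const_add (C q D)
      rw [NNReal.coe_zero, add_zero] at this
      exact (continuous_real_toNNReal.tendsto _).comp this
    have h2 : Tendsto (fun k => (1 + η k) * K) atTop (𝓝 K) := by
      simpa using (hη.const_add 1).mul_const K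
    exact h1.mul h2
  have hmm : Measurable (Prod.map ιY ιY) := hιYm.prodMap hιYm
  obtain ⟨p', hp'geo, hp'le, hp'S⟩ := BIP.exists_limit_plan (hl.comp hnt) hl0 (zero_lt_one.trans hq)
    hBD hpgeo hct hple hη
    (S := {β' | ∃ β, BIP.IsCoupling μ₀ μ₁ β ∧
      (β' : Measure (Z × Z)) = β.map (Prod.map ιY ιY)}) (by
      rintro β' ⟨β, hβ, hββ'⟩ k
      obtain ⟨α, h0, h1, h2, h3, h4⟩ := hpα k β hβ
      exact ⟨α, h0, h1, h2, h3, by rw [hββ']; exact h4⟩)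
  have hp'β : ∀ β, BIP.IsCoupling μ₀ μ₁ β →
      (p' : Measure (BIP.Curve Z)).map (fun γ => γ 0) = μ₀.map ιY ∧
      (p' : Measure (BIP.Curve Z)).map (fun γ => γ 1) = μ₁.map ιY ∧
      ∫⁻ γ, edist (γ 0) (γ 1) ^ q ∂(p' : Measure (BIP.Curve Z)) ≤ BIP.cost q β := fun β hβ => by
    have hβp := hβ.1
    obtain ⟨h0, h1, h2⟩ := hp'S
      ⟨β.map (Prod.map ιY ιY), Measure.isProbabilityMeasure_map hmm.aemeasurable⟩ ⟨β, hβ, rfl⟩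
    rw [ProbabilityMeasure.coe_mk] at h0 h1 h2
    refine ⟨?_, ?_, ?_⟩
    · rw [h0, ← hβ.2.1, Measure.map_map measurable_fst hmm, Measure.map_map hιYm measurable_fst]
      rfl
    · rw [h1, ← hβ.2.2, Measure.map_map measurable_snd hmm, Measure.map_map hιYm measurable_snd]
      rfl
    · rw [lintegral_map (by fun_prop) hmm] at h2
      simpa [BIP.cost, hιY.edist_eq] using h2
  -- The endpoint marginals of `p'` are read off from any one coupling; the product always exists.
  obtain ⟨h0, h1, -⟩ := hp'β (μ₀.prod μ₁) ⟨inferInstance, by simp, by simp⟩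
  obtain ⟨π, hπ, hπle⟩ := BIP.exists_isOptGeo_of_ambient (m := minf) hιY hp'geo
    (c := (C q D).toNNReal * K) (fun t => (hp'le t).trans (Measure.le_iff.2 fun s _ => by
      simp only [Measure.smul_apply]
      gcongr)) h0 h1 fun β hβ => (hp'β β hβ).2.2
  refine ⟨π, hπ, fun t => ?_⟩
  have := BIP.densityNorm_le_of_le_smul (K := ((C q D).toNNReal * K : NNReal)) (hπle t)
  rw [← hK]
  rwa [ENNReal.coe_mul] at this
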